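/- Let $F$ be a field and let $\Omega$ be a set with maps $s,t\colon\Omega\to\mathbb Z_{\ge 0}$. An $\Omega$-algebra is an $F$-vector space $A$ with linear maps $\omega_A\colon A^{\otimes s(\omega)}\to A^{\otimes t(\omega)}$ for all $\omega\in\Omega$ (where $A^{\otimes 0}=F$). For a (coassociative, counital) coalgebra $P$, a linear map $\psi\colon P\otimes A\to A$ is a measuring if $\psi_{t(\omega)}(p\otimes\omega_A(x))=\omega_A(\psi_{s(\omega)}(p\otimes x))$ for all $\omega\in\Omega$, $p\in P$, $x\in A^{\otimes s(\omega)}$, where $\psi_n(p\otimes a_1\otimes\dots\otimes a_n)=\psi(p_{(1)}\otimes a_1)\otimes\dots\otimes\psi(p_{(n)}\otimes a_n)$ and $\psi_0(p)=\varepsilon(p)$; its cosupport is $\{\psi(p\otimes -)\mid p\in P\}\subseteq\operatorname{End}_F(A)$. For a unital associative algebra $Q$, a linear map $\rho\colon A\to A\otimes Q$, $\rho(a)=a_{(0)}\otimes a_{(1)}$, is a comeasuring if $\rho_{t(\omega)}\circ\omega_A=(\omega_A\otimes\mathrm{id}_Q)\circ\rho_{s(\omega)}$ for all $\omega\in\Omega$,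 where $\rho_n(a_1\otimes\dots\otimes a_n)=(a_1)_{(0)}\otimes\dots\otimes(a_n)_{(0)}\otimes(a_1)_{(1)}\cdots(a_n)_{(1)}$ and $\rho_0(\alpha)=\alpha 1_Q$; put $\rho^\vee\colon Q^*\otimes A\to A$, $\rho^\vee(q\otimes a)=q(a_{(1)})a_{(0)}$, and let the cosupport of $\rho$ be $\{\rho^\vee(q\otimes -)\mid q\in Q^*\}$. An action (coaction) of a bialgebra on $A$ is a unital left module structure that is a measuring (respectively, a counital right comodule structure that is a comeasuring). Let $V\subseteq\operatorname{End}_F(A)$ be a unital subalgebra. The $V$-universal acting bialgebra $({}_\square\mathcal B(A,V),\psi_{A,V})$ is the terminal object among all measurings $P\otimes A\to A$ with cosupport contained in $V$ ($P$ running over all coalgebras), with the bialgebra structure on it that makes $\psi_{A,V}$ an action. The $V$-universal coacting bialgebra $(\mathcal B^\square(A,V),\rho_{A,V})$ is the initial object among all comeasurings $A\to A\otimes Q$ with cosupport contained in $V$ ($Q$ running over all unital associative algebras), with the bialgebra structure on it that makes $\rho_{A,V}$ a coaction. For a bialgebra $B$, let $B^\circ\subseteq B^*$ be its finite dual, i.e.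 the bialgebra of all functionals that vanish on a two-sided ideal of finite codimension, with $(fg)(b)=f(b_{(1)})g(b_{(2)})$, unit $\varepsilon_B$, $\Delta f=f_{(1)}\otimes f_{(2)}$ determined by $f(ab)=f_{(1)}(a)f_{(2)}(b)$, and counit $f\mapsto f(1)$. **Theorem.** Let $A$ be an $\Omega$-algebra and let $V\subseteq\operatorname{End}_F(A)$ be a unital subalgebra that is pointwise finite dimensional ($Va=\{va\mid v\in V\}$ is finite dimensional for every $a\in A$) and closed in the finite topology of $\operatorname{End}_F(A)$ (the topology with base the sets $\{f\mid f(a_1)=b_1,\dots,f(a_n)=b_n\}$). Then ${}_\square\mathcal B(A,V)$ and $\mathcal B^\square(A,V)$ exist, there is a unique bialgebra homomorphism $\theta\colon\mathcal B^\square(A,V)^\circ\to{}_\square\mathcal B(A,V)$ such that $$\psi_{A,V}(\theta(f)\otimes a)=\rho_{A,V}^\vee(f\otimes a)\qquad\text{for all } f\in\mathcal B^\square(A,V)^\circ,\ a\in A,$$ and $\theta$ is an isomorphism of bialgebras. In particular, for every finite dimensional unital associative algebra $A$ (an $\Omega$-algebra with $\Omega=\{\mu,u\}$, the multiplication and the unit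 map) and every finite dimensional coalgebra $C$ (an $\Omega$-algebra with $\Omega=\{\Delta,\varepsilon\}$), the universal bialgebras with $V=\operatorname{End}_F(A)$, respectively $V=\operatorname{End}_F(C)$, exist and there are isomorphisms of bialgebras $${}_\square\mathcal B(A,\operatorname{End}_F(A))\cong\mathcal B^\square(A,\operatorname{End}_F(A))^\circ,\qquad {}_\square\mathcal B(C,\operatorname{End}_F(C))\cong\mathcal B^\square(C,\operatorname{End}_F(C))^\circ .$$ -/

import Mathlib

open scoped TensorProduct

universe u v w

noncomputable section

namespace OmegaDuality

/-! ### The finite dual of an algebra, and of a bialgebra -/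

section FiniteDual

variable (F : Type u) [Field F] (A : Type v) [Ring A] [Algebra F A]

/-- The linear functionals on `A` that vanish on a two-sided ideal of finite codimension. -/
def finiteDualSubmodule : Submodule F (Module.Dual F A) where
  carrier := {f | ∃ I : Submodule F A, (∀ a x : A, x ∈ I → a * x ∈ I ∧ x * a ∈ I) ∧
    FiniteDimensional F (A ⧸ I) ∧ ∀ x ∈ I, f x = 0}
  zero_mem' := ⟨⊤, fun _ _ _ => ⟨trivial, trivial⟩, inferInstance, fun _ _ => rfl⟩
  add_mem' := by
    rintro f g ⟨I, hI, hIf, hf⟩ ⟨J, hJ, hJf, hg⟩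
    refine ⟨I ⊓ J, fun a x hx => ⟨⟨(hI a x hx.1).1, (hJ a x hx.2).1⟩,
      ⟨(hI a x hx.1).2, (hJ a x hx.2).2⟩⟩, ?_, fun x hx => ?_⟩
    · have h : I ⊓ J = LinearMap.ker (I.mkQ.prod J.mkQ) := by
        rw [LinearMap.ker_prod, Submodule.ker_mkQ, Submodule.ker_mkQ]
      rw [h]
      exact (LinearMap.quotKerEquivRange (I.mkQ.prod J.mkQ)).symm.finiteDimensional
    · rw [LinearMap.add_apply, hf x hx.1, hg x hx.2, add_zero]
  smul_mem' := by
    rintro c f ⟨I, hI, hIf, hf⟩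
    exact ⟨I, hI, hIf, fun x hx => by rw [LinearMap.smul_apply, hf x hx, smul_zero]⟩

/-- The finite dual of an algebra. -/
def FiniteDual : Type (max u v) := finiteDualSubmodule F A

instance : AddCommGroup (FiniteDual F A) :=
  inferInstanceAs (AddCommGroup (finiteDualSubmodule F A))

instance : Module F (FiniteDual F A) :=
  inferInstanceAs (Module F (finiteDualSubmodule F A))

/-- The inclusion of the finite dual into the full linear dual. -/
def FiniteDual.toDual : FiniteDual F A →ₗ[F] Module.Dual F A :=
  (finiteDualSubmodule F A).subtype

variable {F A}

theorem FiniteDual.toDual_injective : Function.Injective (FiniteDual.toDual F A) :=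
  Subtype.val_injective

/-- Evaluation at `a`, as a functional on the finite dual. -/
def FiniteDual.ev (a : A) : FiniteDual F A →ₗ[F] F :=
  (LinearMap.applyₗ a).comp (FiniteDual.toDual F A)

theorem FiniteDual.ev_apply (a : A) (f : FiniteDual F A) :
    FiniteDual.ev a f = FiniteDual.toDual F A f a := rfl

theorem FiniteDual.ext_ev {f g : FiniteDual F A}
    (h : ∀ a : A, FiniteDual.ev a f = FiniteDual.ev a g) : f = g :=
  FiniteDual.toDual_injective (LinearMap.ext h)

/-- The product of two functionals as a functional on the tensor product. -/
def pairing {M N : Type*} [AddCommGroup M] [Module F M] [AddCommGroup N] [Module F N]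
    (φ : M →ₗ[F] F) (χ : N →ₗ[F] F) : M ⊗[F] N →ₗ[F] F :=
  (LinearMap.mul' F F).comp (TensorProduct.map φ χ)

@[simp] theorem pairing_tmul {M N : Type*} [AddCommGroup M] [Module F M] [AddCommGroup N]
    [Module F N] (φ : M →ₗ[F] F) (χ : N →ₗ[F] F) (m : M) (n : N) :
    pairing φ χ (m ⊗ₜ n) = φ m * χ n := by
  simp [pairing]

/-- Products of members of two separating families of functionals separate the points of the
tensor product. -/
theorem tensor_eq_zero_of_pairing {M N X Y : Type*} [AddCommGroup M] [Module F M]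
    [AddCommGroup N] [Module F N] (φ : X → M →ₗ[F] F) (χ : Y → N →ₗ[F] F)
    (hφ : ∀ m, (∀ x, φ x m = 0) → m = 0) (hχ : ∀ n, (∀ y, χ y n = 0) → n = 0)
    (t : M ⊗[F] N) (ht : ∀ x y, pairing (φ x) (χ y) t = 0) : t = 0 := by
  classical
  let b := Module.Basis.ofVectorSpace F N
  let e := TensorProduct.equivFinsuppOfBasisRight (M := M) b
  apply e.injective
  rw [map_zero]
  ext i
  apply hφ
  intro x
  have key : ∀ s : M ⊗[F] N, TensorProduct.lid F N (TensorProduct.map (φ x) LinearMap.id s) =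
      (e s).sum fun i m => φ x m • b i := by
    intro s
    have hs : s = e.symm (e s) := (e.symm_apply_apply s).symm
    conv_lhs => rw [hs]
    generalize e s = c
    induction c using Finsupp.induction_linear with
    | zero => simp
    | add p q hp hq =>
      rw [map_add, map_add, map_add, hp, hq, Finsupp.sum_add_index'] <;> simp [add_smul]
    | single j m => simp [e]
  have h0 : TensorProduct.lid F N (TensorProduct.map (φ x) LinearMap.id t) = 0 := by
    apply hχ
    intro y
    rw [← ht x y]
    have : (χ y).comp ((TensorProduct.lid F N).toLinearMap.comp
        (TensorProduct.map (φ x) LinearMap.id)) = pairing (φ x) (χ y) := by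
      ext m n
      simp
    exact LinearMap.congr_fun this t
  rw [key] at h0
  have h1 := congrArg (fun n => b.repr n i) h0
  simp only [map_zero, Finsupp.coe_zero, Pi.zero_apply] at h1
  rw [Finsupp.sum, map_sum, Finsupp.finsetSum_apply] at h1
  by_cases hi : i ∈ (e t).support
  · rw [Finset.sum_eq_single i] at h1
    · simpa using h1
    · intro j _ hj
      simp [Finsupp.single_eq_of_ne hj.symm]
    · exact fun h => absurd hi h
  · rw [Finsupp.notMem_support_iff] at hi
    simp [hi]

theorem FiniteDual.ev_separates (f : FiniteDual F A) (h : ∀ a : A, FiniteDual.ev a f = 0) :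
    f = 0 :=
  FiniteDual.ext_ev fun a => by rw [h a, map_zero]

theorem FiniteDual.tensor_ext {s t : FiniteDual F A ⊗[F] FiniteDual F A}
    (h : ∀ a b : A, pairing (FiniteDual.ev a) (FiniteDual.ev b) s =
      pairing (FiniteDual.ev a) (FiniteDual.ev b) t) : s = t := by
  rw [← sub_eq_zero]
  refine tensor_eq_zero_of_pairing (fun a : A => FiniteDual.ev a) (fun b : A => FiniteDual.ev b)
    FiniteDual.ev_separates FiniteDual.ev_separates _ fun a b => ?_
  rw [map_sub, h, sub_self]

theorem FiniteDual.tensor_ext₃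
    {s t : FiniteDual F A ⊗[F] (FiniteDual F A ⊗[F] FiniteDual F A)}
    (h : ∀ a b c : A,
      pairing (FiniteDual.ev a) (pairing (FiniteDual.ev b) (FiniteDual.ev c)) s =
      pairing (FiniteDual.ev a) (pairing (FiniteDual.ev b) (FiniteDual.ev c)) t) : s = t := by
  rw [← sub_eq_zero]
  refine tensor_eq_zero_of_pairing (fun a : A => FiniteDual.ev a)
    (fun p : A × A => pairing (FiniteDual.ev p.1) (FiniteDual.ev p.2))
    FiniteDual.ev_separates (fun n hn => FiniteDual.tensor_ext fun a b => ?_) _ fun a p => ?_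
  · rw [hn (a, b), map_zero]
  · rw [map_sub, h, sub_self]

theorem FiniteDual.exists_comul (f : FiniteDual F A) :
    ∃ t : FiniteDual F A ⊗[F] FiniteDual F A, ∀ a b : A,
      pairing (FiniteDual.ev a) (FiniteDual.ev b) t = FiniteDual.ev (a * b) f := by
  classical
  obtain ⟨f, I, hI, hfin, hf⟩ := f
  let e := Module.finBasis F (A ⧸ I)
  have hl : ∀ i, ∃ c : A, I.mkQ c = e i := fun i => I.mkQ_surjective (e i)
  choose c hc using hl
  let g₁ : Fin (Module.finrank F (A ⧸ I)) → FiniteDual F A := fun i =>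
    ⟨f.comp (LinearMap.mulRight F (c i)), I, hI, hfin, fun x hx => hf _ (hI (c i) x hx).2⟩
  let g₂ : Fin (Module.finrank F (A ⧸ I)) → FiniteDual F A := fun i =>
    ⟨(e.coord i).comp I.mkQ, I, hI, hfin, fun x hx => by
      have : I.mkQ x = 0 := (Submodule.Quotient.mk_eq_zero I).2 hx
      rw [LinearMap.comp_apply, this, map_zero]⟩
  refine ⟨∑ i, g₁ i ⊗ₜ g₂ i, fun a b => ?_⟩
  have h1 : ∀ i, FiniteDual.ev a (g₁ i) = f (a * c i) := fun i => rfl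
  have h2 : ∀ i, FiniteDual.ev b (g₂ i) = e.repr (I.mkQ b) i := fun i => rfl
  have h3 : b - ∑ i, e.repr (I.mkQ b) i • c i ∈ I := by
    refine (Submodule.Quotient.mk_eq_zero I).1 ?_
    change I.mkQ _ = 0
    rw [map_sub, map_sum]
    simp only [map_smul, hc]
    rw [e.sum_repr, sub_self]
  have h4 := hf _ (hI a _ h3).1
  rw [mul_sub, map_sub, sub_eq_zero] at h4
  change _ = f (a * b)
  rw [h4, Finset.mul_sum, map_sum, map_sum]
  refine Finset.sum_congr rfl fun i _ => ?_
  rw [pairing_tmul, h1, h2, mul_smul_comm, map_smul, smul_eq_mul, mul_comm]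

/-- The comultiplication of the finite dual, characterised by `(Δ f)(a ⊗ b) = f (a * b)`. -/
def FiniteDual.comulMap : FiniteDual F A →ₗ[F] FiniteDual F A ⊗[F] FiniteDual F A where
  toFun f := (FiniteDual.exists_comul f).choose
  map_add' f g := FiniteDual.tensor_ext fun a b => by
    rw [map_add, (FiniteDual.exists_comul _).choose_spec, (FiniteDual.exists_comul f).choose_spec,
      (FiniteDual.exists_comul g).choose_spec, map_add]
  map_smul' c f := FiniteDual.tensor_ext fun a b => by
    rw [map_smul, (FiniteDual.exists_comul _).choose_spec,
      (FiniteDual.exists_comul f).choose_spec, map_smul, RingHom.id_apply]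

theorem FiniteDual.pairing_comulMap (a b : A) (f : FiniteDual F A) :
    pairing (FiniteDual.ev a) (FiniteDual.ev b) (FiniteDual.comulMap f) =
      FiniteDual.ev (a * b) f :=
  (FiniteDual.exists_comul f).choose_spec a b

/-- The coalgebra structure of the finite dual: `(Δ f)(a ⊗ b) = f (a * b)`, `ε f = f 1`. -/
instance : Coalgebra F (FiniteDual F A) where
  comul := FiniteDual.comulMap
  counit := FiniteDual.ev 1
  coassoc := by
    ext f
    refine FiniteDual.tensor_ext₃ fun a b c => ?_
    have h1 : ∀ t : FiniteDual F A ⊗[F] FiniteDual F A,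
        pairing (FiniteDual.ev a) (pairing (FiniteDual.ev b) (FiniteDual.ev c))
          (TensorProduct.assoc F _ _ _ (FiniteDual.comulMap.rTensor (FiniteDual F A) t)) =
        pairing (FiniteDual.ev (a * b)) (FiniteDual.ev c) t := by
      intro t
      induction t with
      | zero => simp
      | add x y hx hy => simp only [map_add, hx, hy]
      | tmul x y =>
        rw [LinearMap.rTensor_tmul, pairing_tmul, ← FiniteDual.pairing_comulMap]
        generalize FiniteDual.comulMap x = s
        induction s with
        | zero => simp
        | add p q hp hq => simp only [TensorProduct.add_tmul, map_add, hp, hq, add_mul]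
        | tmul p q => simp [mul_assoc]
    have h2 : ∀ t : FiniteDual F A ⊗[F] FiniteDual F A,
        pairing (FiniteDual.ev a) (pairing (FiniteDual.ev b) (FiniteDual.ev c))
          (FiniteDual.comulMap.lTensor (FiniteDual F A) t) =
        pairing (FiniteDual.ev a) (FiniteDual.ev (b * c)) t := by
      intro t
      induction t with
      | zero => simp
      | add x y hx hy => simp only [map_add, hx, hy]
      | tmul x y =>
        rw [LinearMap.lTensor_tmul, pairing_tmul, pairing_tmul, FiniteDual.pairing_comulMap]
    simp only [LinearMap.comp_apply, LinearEquiv.coe_coe, h1, h2, FiniteDual.pairing_comulMap,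
      mul_assoc]
  rTensor_counit_comp_comul := by
    ext f
    apply (TensorProduct.lid F (FiniteDual F A)).injective
    refine FiniteDual.ext_ev fun b => ?_
    have h : ∀ t : FiniteDual F A ⊗[F] FiniteDual F A,
        FiniteDual.ev b (TensorProduct.lid F _ ((FiniteDual.ev 1).rTensor (FiniteDual F A) t)) =
          pairing (FiniteDual.ev 1) (FiniteDual.ev b) t := by
      intro t
      induction t with
      | zero => simp
      | add x y hx hy => simp only [map_add, hx, hy]
      | tmul x y => simp
    simp only [LinearMap.comp_apply, h, FiniteDual.pairing_comulMap, one_mul]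
    simp
  lTensor_counit_comp_comul := by
    ext f
    apply (TensorProduct.rid F (FiniteDual F A)).injective
    refine FiniteDual.ext_ev fun b => ?_
    have h : ∀ t : FiniteDual F A ⊗[F] FiniteDual F A,
        FiniteDual.ev b (TensorProduct.rid F _ ((FiniteDual.ev 1).lTensor (FiniteDual F A) t)) =
          pairing (FiniteDual.ev b) (FiniteDual.ev 1) t := by
      intro t
      induction t with
      | zero => simp
      | add x y hx hy => simp only [map_add, hx, hy]
      | tmul x y => simp [mul_comm]
    simp only [LinearMap.comp_apply, h, FiniteDual.pairing_comulMap, mul_one]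
    simp

end FiniteDual

section FiniteDualBialgebra

variable {F : Type u} [Field F]

theorem finiteDimensional_quotient_ker {M N : Type*} [AddCommGroup M] [Module F M]
    [AddCommGroup N] [Module F N] [FiniteDimensional F N] (T : M →ₗ[F] N) :
    FiniteDimensional F (M ⧸ LinearMap.ker T) :=
  (LinearMap.quotKerEquivRange T).symm.finiteDimensional

/-- A sufficient condition for membership in the finite dual: `h (a * (x * b))` is a finite sum
of products of functionals of `a`, `x` and `b`. -/
theorem mem_finiteDualSubmodule_of_sum {A : Type v} [Ring A] [Algebra F A] {ι κ : Type*}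
    (h : Module.Dual F A) (p q : ι → Module.Dual F A) (s : Finset ι)
    (r u : ι → κ → Module.Dual F A) (t : ι → Finset κ)
    (hpq : ∀ a b : A, h (a * b) = ∑ i ∈ s, p i a * q i b)
    (hru : ∀ i, ∀ a b : A, q i (a * b) = ∑ j ∈ t i, r i j a * u i j b) :
    h ∈ finiteDualSubmodule F A := by
  let I : Submodule F A :=
    { carrier := {x | ∀ a b : A, h (a * (x * b)) = 0}
      zero_mem' := fun a b => by simp
      add_mem' := fun {x y} hx hy a b => by rw [add_mul, mul_add, map_add, hx, hy, add_zero]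
      smul_mem' := fun c x hx a b => by
        rw [smul_mul_assoc, mul_smul_comm, map_smul, hx, smul_zero] }
  let T : A →ₗ[F] ({k // k ∈ s.sigma t} → F) :=
    LinearMap.pi fun k => r k.1.1 k.1.2
  have hTI : LinearMap.ker T ≤ I := by
    intro x hx a b
    rw [hpq]
    refine Finset.sum_eq_zero fun i hi => ?_
    rw [hru, Finset.sum_eq_zero, mul_zero]
    intro j hj
    have h1 : r i j x = 0 :=
      congrFun (LinearMap.mem_ker.1 hx) ⟨⟨i, j⟩, Finset.mem_sigma.2 ⟨hi, hj⟩⟩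
    rw [h1, zero_mul]
  have hT := finiteDimensional_quotient_ker T
  refine ⟨I, fun a x hx => ⟨fun c b => ?_, fun c b => ?_⟩,
    Module.Finite.of_surjective (Submodule.factor hTI) (Submodule.factor_surjective hTI),
    fun x hx => ?_⟩
  · rw [mul_assoc, ← mul_assoc]
    exact hx _ _
  · rw [mul_assoc]
    exact hx _ _
  · have h1 := hx 1 1
    rwa [mul_one, one_mul] at h1

variable {B : Type v} [Ring B] [Bialgebra F B]

theorem pairing_mul_eq_sum {ι κ : Type*} (f g : Module.Dual F B)
    (f₁ f₂ : ι → Module.Dual F B) (g₁ g₂ : κ → Module.Dual F B) (s : Finset ι) (t : Finset κ)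
    (hf : ∀ a b : B, f (a * b) = ∑ i ∈ s, f₁ i a * f₂ i b)
    (hg : ∀ a b : B, g (a * b) = ∑ j ∈ t, g₁ j a * g₂ j b) (x y : B ⊗[F] B) :
    pairing f g (x * y) =
      ∑ k ∈ s ×ˢ t, pairing (f₁ k.1) (g₁ k.2) x * pairing (f₂ k.1) (g₂ k.2) y := by
  induction x with
  | zero => simp
  | add x x' hx hx' => simp only [add_mul, map_add, hx, hx', Finset.sum_add_distrib]
  | tmul a a' =>
    induction y with
    | zero => simp
    | add y y' hy hy' => simp only [mul_add, map_add, hy, hy', Finset.sum_add_distrib]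
    | tmul b b' =>
      simp only [Algebra.TensorProduct.tmul_mul_tmul, pairing_tmul, hf, hg]
      rw [Finset.sum_mul_sum, ← Finset.sum_product']
      exact Finset.sum_congr rfl fun k _ => by ring

/-- `f (a * b)` expanded along a presentation of the comultiplication of `f`. -/
theorem FiniteDual.ev_mul_eq_sum {A : Type v} [Ring A] [Algebra F A] {ι : Type*}
    {f : FiniteDual F A} (r : Coalgebra.Repr F f ι) (a b : A) :
    FiniteDual.toDual F A f (a * b) = ∑ i ∈ r.index,
      FiniteDual.toDual F A (r.left i) a * FiniteDual.toDual F A (r.right i) b := by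
  have h := FiniteDual.pairing_comulMap a b f
  have h2 : FiniteDual.comulMap f = ∑ i ∈ r.index, r.left i ⊗ₜ[F] r.right i := r.eq.symm
  rw [h2, map_sum] at h
  rw [← FiniteDual.ev_apply, ← h]
  exact Finset.sum_congr rfl fun i _ => pairing_tmul _ _ _ _

/-- The convolution of two functionals `(f * g) b = f b₁ * g b₂` on a coalgebra. -/
def convDual (f g : Module.Dual F B) : Module.Dual F B :=
  (pairing f g).comp Coalgebra.comul

theorem convDual_mul (f g : FiniteDual F B) (a b : B) :
    convDual (FiniteDual.toDual F B f) (FiniteDual.toDual F B g) (a * b) =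
      ∑ k ∈ (Coalgebra.Repr.arbitrary F f).index ×ˢ (Coalgebra.Repr.arbitrary F g).index,
        convDual (FiniteDual.toDual F B ((Coalgebra.Repr.arbitrary F f).left k.1))
          (FiniteDual.toDual F B ((Coalgebra.Repr.arbitrary F g).left k.2)) a *
        convDual (FiniteDual.toDual F B ((Coalgebra.Repr.arbitrary F f).right k.1))
          (FiniteDual.toDual F B ((Coalgebra.Repr.arbitrary F g).right k.2)) b := by
  rw [convDual, LinearMap.comp_apply, Bialgebra.comul_mul]
  exact pairing_mul_eq_sum _ _ _ _ _ _ _ _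
    (FiniteDual.ev_mul_eq_sum (Coalgebra.Repr.arbitrary F f))
    (FiniteDual.ev_mul_eq_sum (Coalgebra.Repr.arbitrary F g)) _ _

/-- The product of the finite dual of a bialgebra is convolution. -/
instance : Mul (FiniteDual F B) where
  mul f g := ⟨convDual (FiniteDual.toDual F B f) (FiniteDual.toDual F B g),
    mem_finiteDualSubmodule_of_sum _ _ _ _ _ _ _ (convDual_mul f g)
      fun _ => convDual_mul _ _⟩

/-- The unit of the finite dual of a bialgebra is the counit of the bialgebra. -/
instance : One (FiniteDual F B) where
  one := ⟨Coalgebra.counit, LinearMap.ker Coalgebra.counit,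
    fun a x hx => by
      rw [LinearMap.mem_ker] at hx
      simp only [LinearMap.mem_ker, Bialgebra.counit_mul, hx, mul_zero, zero_mul, and_self],
    finiteDimensional_quotient_ker _, fun _ hx => hx⟩

theorem FiniteDual.toDual_mul (f g : FiniteDual F B) :
    FiniteDual.toDual F B (f * g) =
      convDual (FiniteDual.toDual F B f) (FiniteDual.toDual F B g) := rfl

theorem FiniteDual.toDual_one :
    FiniteDual.toDual F B (1 : FiniteDual F B) = Coalgebra.counit := rfl

/-- The finite dual inside the convolution algebra of all functionals. -/
def FiniteDual.toConv (f : FiniteDual F B) : WithConv (B →ₗ[F] F) :=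
  WithConv.toConv (FiniteDual.toDual F B f)

theorem FiniteDual.toConv_injective :
    Function.Injective (FiniteDual.toConv : FiniteDual F B → WithConv (B →ₗ[F] F)) :=
  WithConv.toConv_injective.comp FiniteDual.toDual_injective

theorem FiniteDual.toConv_mul (f g : FiniteDual F B) :
    FiniteDual.toConv (f * g) = FiniteDual.toConv f * FiniteDual.toConv g := rfl

theorem FiniteDual.toConv_add (f g : FiniteDual F B) :
    FiniteDual.toConv (f + g) = FiniteDual.toConv f + FiniteDual.toConv g := rfl

theorem FiniteDual.toConv_smul (c : F) (f : FiniteDual F B) :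
    FiniteDual.toConv (c • f) = c • FiniteDual.toConv f := rfl

theorem FiniteDual.toConv_zero : FiniteDual.toConv (0 : FiniteDual F B) = 0 := rfl

theorem FiniteDual.toConv_one : FiniteDual.toConv (1 : FiniteDual F B) = 1 := rfl

instance : Ring (FiniteDual F B) :=
  { (inferInstance : AddCommGroup (FiniteDual F B)),
    (inferInstance : Mul (FiniteDual F B)),
    (inferInstance : One (FiniteDual F B)) with
    mul_assoc := fun f g h => FiniteDual.toConv_injective
      (by simp only [FiniteDual.toConv_mul, mul_assoc])
    one_mul := fun f => FiniteDual.toConv_injective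
      (by simp only [FiniteDual.toConv_mul, FiniteDual.toConv_one, one_mul])
    mul_one := fun f => FiniteDual.toConv_injective
      (by simp only [FiniteDual.toConv_mul, FiniteDual.toConv_one, mul_one])
    left_distrib := fun f g h => FiniteDual.toConv_injective
      (by simp only [FiniteDual.toConv_mul, FiniteDual.toConv_add, mul_add])
    right_distrib := fun f g h => FiniteDual.toConv_injective
      (by simp only [FiniteDual.toConv_mul, FiniteDual.toConv_add, add_mul])
    zero_mul := fun f => FiniteDual.toConv_injective
      (by simp only [FiniteDual.toConv_mul, FiniteDual.toConv_zero, zero_mul])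
    mul_zero := fun f => FiniteDual.toConv_injective
      (by simp only [FiniteDual.toConv_mul, FiniteDual.toConv_zero, mul_zero]) }

instance : Algebra F (FiniteDual F B) :=
  Algebra.ofModule
    (fun c f g => FiniteDual.toConv_injective
      (by simp only [FiniteDual.toConv_mul, FiniteDual.toConv_smul, smul_mul_assoc]))
    (fun c f g => FiniteDual.toConv_injective
      (by simp only [FiniteDual.toConv_mul, FiniteDual.toConv_smul, mul_smul_comm]))

/-- The bialgebra structure of the finite dual of a bialgebra. -/
instance : Bialgebra F (FiniteDual F B) :=
  Bialgebra.mk' F (FiniteDual F B)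
    (by
      change Coalgebra.counit (R := F) (1 : B) = 1
      exact Bialgebra.counit_one)
    (by
      intro f g
      change pairing (FiniteDual.toDual F B f) (FiniteDual.toDual F B g)
        (Coalgebra.comul (1 : B)) = _
      rw [Bialgebra.comul_one, Algebra.TensorProduct.one_def, pairing_tmul]
      rfl)
    (by
      refine FiniteDual.tensor_ext fun a b => ?_
      refine (FiniteDual.pairing_comulMap a b 1).trans ?_
      rw [Algebra.TensorProduct.one_def, pairing_tmul, FiniteDual.ev_apply, FiniteDual.ev_apply,
        FiniteDual.ev_apply, FiniteDual.toDual_one, Bialgebra.counit_mul])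
    (by
      intro f g
      refine FiniteDual.tensor_ext fun a b => ?_
      refine (FiniteDual.pairing_comulMap a b (f * g)).trans ?_
      have hf : Coalgebra.comul f = _ := (Coalgebra.Repr.arbitrary F f).eq.symm
      have hg : Coalgebra.comul g = _ := (Coalgebra.Repr.arbitrary F g).eq.symm
      rw [hf, hg, Finset.sum_mul_sum, ← Finset.sum_product', map_sum, FiniteDual.ev_apply,
        FiniteDual.toDual_mul, convDual_mul]
      refine Finset.sum_congr rfl fun k _ => ?_
      rw [Algebra.TensorProduct.tmul_mul_tmul, pairing_tmul]
      rfl)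

end FiniteDualBialgebra

/-! ### Finite topology and cosupports -/

section LinearMaps

variable {F : Type u} [Field F] {A B : Type*} [AddCommGroup A] [Module F A]
  [AddCommGroup B] [Module F B]

variable (F A B) in
/-- The finite topology on the space of linear maps `A → B`: its basic open sets consist of the
maps with prescribed values at finitely many points. -/
abbrev finiteTopology : TopologicalSpace (A →ₗ[F] B) :=
  TopologicalSpace.generateFrom
    {W | ∃ (n : ℕ) (a : Fin n → A) (b : Fin n → B), W = {f | ∀ i, f (a i) = b i}}

/-- `V` is closed in the finite topology. -/
def IsFinitelyClosed (V : Submodule F (A →ₗ[F] B)) : Prop :=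
  @IsClosed _ (finiteTopology F A B) (V : Set (A →ₗ[F] B))

/-- `V a = {v a | v ∈ V}` is finite dimensional for every `a`. -/
def IsPointwiseFiniteDimensional (V : Submodule F (A →ₗ[F] B)) : Prop :=
  ∀ a : A, FiniteDimensional F (V.map (LinearMap.applyₗ a))

/-- The cosupport of `ψ : P ⊗ A → B`: all linear maps `ψ (p ⊗ -)`. -/
def actCosupp {P : Type*} [AddCommGroup P] [Module F P] (ψ : P ⊗[F] A →ₗ[F] B) :
    Submodule F (A →ₗ[F] B) :=
  LinearMap.range (TensorProduct.curry ψ)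

/-- For `ρ : A → B ⊗ Q`, the map `Q* → Hom(A, B)`, `q ↦ (a ↦ q(a₁) a₀)`. -/
def veeHom {Q : Type*} [AddCommGroup Q] [Module F Q] (ρ : A →ₗ[F] B ⊗[F] Q) :
    Module.Dual F Q →ₗ[F] A →ₗ[F] B where
  toFun q := (TensorProduct.rid F B).toLinearMap ∘ₗ q.lTensor B ∘ₗ ρ
  map_add' q q' := by
    ext a
    simp [LinearMap.lTensor_add]
  map_smul' c q := by
    ext a
    simp [LinearMap.lTensor_smul]

/-- The map `ρ^∨ : Q* ⊗ A → B`, `q ⊗ a ↦ q(a₁) a₀`. -/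
def vee {Q : Type*} [AddCommGroup Q] [Module F Q] (ρ : A →ₗ[F] B ⊗[F] Q) :
    Module.Dual F Q ⊗[F] A →ₗ[F] B :=
  TensorProduct.lift (veeHom ρ)

/-- The cosupport of `ρ : A → B ⊗ Q` is the cosupport of `ρ^∨`. -/
def coactCosupp {Q : Type*} [AddCommGroup Q] [Module F Q] (ρ : A →ₗ[F] B ⊗[F] Q) :
    Submodule F (A →ₗ[F] B) :=
  actCosupp (vee ρ)

/-- The restriction of `ρ^∨` to `Q° ⊗ A`. -/
def veeFin {Q : Type*} [Ring Q] [Algebra F Q] (ρ : A →ₗ[F] B ⊗[F] Q) :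
    FiniteDual F Q ⊗[F] A →ₗ[F] B :=
  vee ρ ∘ₗ (FiniteDual.toDual F Q).rTensor A

end LinearMaps

/-! ### Omega-algebras, measurings and comeasurings -/

/-- An `Ω`-algebra structure on `A`, where `s` and `t` are the source and target of the span `Ω`:
a linear map `A^{⊗ s ω} → A^{⊗ t ω}` for each `ω`. -/
structure OmegaAlgebra (F : Type u) [Field F] {Ω : Type w} (s t : Ω → ℕ) (A : Type v)
    [AddCommGroup A] [Module F A] where
  op : ∀ ω : Ω, ⨂[F]^(s ω) A →ₗ[F] ⨂[F]^(t ω) A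

section Measurings

variable {F : Type u} [Field F] {A B : Type*} [AddCommGroup A] [Module F A]
  [AddCommGroup B] [Module F B]

variable (F A) in
/-- The canonical isomorphism `A^{⊗ 0} ≃ F`. -/
def powZero : ⨂[F]^0 A ≃ₗ[F] F := PiTensorProduct.isEmptyEquiv (Fin 0)

variable (F A) in
/-- The canonical isomorphism `A^{⊗ 1} ≃ A`. -/
def powOne : ⨂[F]^1 A ≃ₗ[F] A := PiTensorProduct.subsingletonEquiv (0 : Fin 1)

variable (F A) in
/-- The canonical isomorphism `A^{⊗ (n + 1)} ≃ A^{⊗ n} ⊗ A`. -/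
def powSucc (n : ℕ) : ⨂[F]^(n + 1) A ≃ₗ[F] ⨂[F]^n A ⊗[F] A :=
  TensorPower.mulEquiv.symm ≪≫ₗ
    TensorProduct.congr (LinearEquiv.refl F (⨂[F]^n A)) (powOne F A)

/-- The maps `ψ_n : P ⊗ A^{⊗ n} → B^{⊗ n}`,
`ψ_n (p ⊗ a₁ ⊗ ⋯ ⊗ a_n) = ψ (p₁ ⊗ a₁) ⊗ ⋯ ⊗ ψ (p_n ⊗ a_n)` and `ψ_0 = ε`, for a coalgebra `P`. -/
def measPow {P : Type*} [AddCommGroup P] [Module F P] [Coalgebra F P] (ψ : P ⊗[F] A →ₗ[F] B) :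
    ∀ n : ℕ, P ⊗[F] ⨂[F]^n A →ₗ[F] ⨂[F]^n B
  | 0 => (powZero F B).symm.toLinearMap ∘ₗ (TensorProduct.lid F F).toLinearMap ∘ₗ
      TensorProduct.map Coalgebra.counit (powZero F A).toLinearMap
  | n + 1 => (powSucc F B n).symm.toLinearMap ∘ₗ TensorProduct.map (measPow ψ n) ψ ∘ₗ
      (TensorProduct.tensorTensorTensorComm F P P (⨂[F]^n A) A).toLinearMap ∘ₗ
      TensorProduct.map Coalgebra.comul (powSucc F A n).toLinearMap

/-- The maps `ρ_n : A^{⊗ n} → B^{⊗ n} ⊗ Q`, where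
`ρ_n (a₁ ⊗ ⋯ ⊗ a_n) = a₁₍₀₎ ⊗ ⋯ ⊗ a_n₍₀₎ ⊗ a₁₍₁₎ ⋯ a_n₍₁₎` and `ρ_0 α = α 1`, for an algebra
`Q`. -/
def comeasPow {Q : Type*} [Ring Q] [Algebra F Q] (ρ : A →ₗ[F] B ⊗[F] Q) :
    ∀ n : ℕ, ⨂[F]^n A →ₗ[F] ⨂[F]^n B ⊗[F] Q
  | 0 => TensorProduct.map (powZero F B).symm.toLinearMap (Algebra.linearMap F Q) ∘ₗ
      (TensorProduct.lid F F).symm.toLinearMap ∘ₗ (powZero F A).toLinearMap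
  | n + 1 => TensorProduct.map (powSucc F B n).symm.toLinearMap (LinearMap.mul' F Q) ∘ₗ
      (TensorProduct.tensorTensorTensorComm F (⨂[F]^n B) Q B Q).toLinearMap ∘ₗ
      TensorProduct.map (comeasPow ρ n) ρ ∘ₗ (powSucc F A n).toLinearMap

variable {Ω : Type w} {s t : Ω → ℕ}

/-- `ψ : P ⊗ A → B` is a measuring. -/
def IsMeasuring (𝒜 : OmegaAlgebra F s t A) (ℬ : OmegaAlgebra F s t B)
    {P : Type*} [AddCommGroup P] [Module F P] [Coalgebra F P] (ψ : P ⊗[F] A →ₗ[F] B) : Prop :=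
  ∀ (ω : Ω) (p : P) (x : ⨂[F]^(s ω) A),
    measPow ψ (t ω) (p ⊗ₜ 𝒜.op ω x) = ℬ.op ω (measPow ψ (s ω) (p ⊗ₜ x))

/-- `ρ : A → B ⊗ Q` is a comeasuring. -/
def IsComeasuring (𝒜 : OmegaAlgebra F s t A) (ℬ : OmegaAlgebra F s t B)
    {Q : Type*} [Ring Q] [Algebra F Q] (ρ : A →ₗ[F] B ⊗[F] Q) : Prop :=
  ∀ (ω : Ω) (x : ⨂[F]^(s ω) A),
    comeasPow ρ (t ω) (𝒜.op ω x) = (ℬ.op ω).rTensor Q (comeasPow ρ (s ω) x)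

end Measurings

/-! ### Universal objects -/

section Universal

variable {F : Type u} [Field F] {A B : Type u} [AddCommGroup A] [Module F A]
  [AddCommGroup B] [Module F B] {Ω : Type w} {s t : Ω → ℕ}

/-- `(P, ψ)` is a terminal object among the measurings from `A` to `B` with cosupport in `V`,
i.e. a `V`-universal measuring coalgebra. -/
structure IsUniversalMeasuring (𝒜 : OmegaAlgebra F s t A) (ℬ : OmegaAlgebra F s t B)
    (V : Submodule F (A →ₗ[F] B)) {P : Type u} [AddCommGroup P] [Module F P] [Coalgebra F P]
    (ψ : P ⊗[F] A →ₗ[F] B) : Prop where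
  isMeasuring : IsMeasuring 𝒜 ℬ ψ
  cosupp_le : actCosupp ψ ≤ V
  existsUnique_hom : ∀ (P' : Type u) [AddCommGroup P'] [Module F P'] [Coalgebra F P']
    (ψ' : P' ⊗[F] A →ₗ[F] B), IsMeasuring 𝒜 ℬ ψ' → actCosupp ψ' ≤ V →
      ∃! φ : P' →ₗc[F] P, ψ ∘ₗ φ.toLinearMap.rTensor A = ψ'

/-- `(Q, ρ)` is an initial object among the comeasurings from `A` to `B` with cosupport in `V`,
i.e. a `V`-universal comeasuring algebra. -/
structure IsUniversalComeasuring (𝒜 : OmegaAlgebra F s t A) (ℬ : OmegaAlgebra F s t B)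
    (V : Submodule F (A →ₗ[F] B)) {Q : Type u} [Ring Q] [Algebra F Q]
    (ρ : A →ₗ[F] B ⊗[F] Q) : Prop where
  isComeasuring : IsComeasuring 𝒜 ℬ ρ
  cosupp_le : coactCosupp ρ ≤ V
  existsUnique_hom : ∀ (Q' : Type u) [Ring Q'] [Algebra F Q']
    (ρ' : A →ₗ[F] B ⊗[F] Q'), IsComeasuring 𝒜 ℬ ρ' → coactCosupp ρ' ≤ V →
      ∃! φ : Q →ₐ[F] Q', φ.toLinearMap.lTensor B ∘ₗ ρ = ρ'

/-- `ψ : H ⊗ A → A` is an action of the bialgebra `H` on the `Ω`-algebra `A`. -/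
structure IsAction (𝒜 : OmegaAlgebra F s t A) {H : Type*} [Ring H] [Bialgebra F H]
    (ψ : H ⊗[F] A →ₗ[F] A) : Prop where
  one_act : ∀ a : A, ψ ((1 : H) ⊗ₜ a) = a
  mul_act : ∀ (g h : H) (a : A), ψ ((g * h) ⊗ₜ a) = ψ (g ⊗ₜ ψ (h ⊗ₜ a))
  isMeasuring : IsMeasuring 𝒜 𝒜 ψ

/-- `ρ : A → A ⊗ H` is a (right) coaction of the bialgebra `H` on the `Ω`-algebra `A`. -/
structure IsCoaction (𝒜 : OmegaAlgebra F s t A) {H : Type*} [Ring H] [Bialgebra F H]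
    (ρ : A →ₗ[F] A ⊗[F] H) : Prop where
  counit_coact : ∀ a : A, (Coalgebra.counit (R := F) (A := H)).lTensor A (ρ a) = a ⊗ₜ 1
  comul_coact : ∀ a : A, TensorProduct.assoc F A H H (ρ.rTensor H (ρ a)) =
    (Coalgebra.comul (R := F) (A := H)).lTensor A (ρ a)
  isComeasuring : IsComeasuring 𝒜 𝒜 ρ

/-- `(H, ψ)` is a `V`-universal acting bialgebra: a `V`-universal measuring coalgebra from `A` to
itself, with the (unique) bialgebra structure for which `ψ` is an action. -/
structure IsUniversalActing (𝒜 : OmegaAlgebra F s t A) (V : Subalgebra F (Module.End F A))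
    {H : Type u} [Ring H] [Bialgebra F H] (ψ : H ⊗[F] A →ₗ[F] A) : Prop where
  isAction : IsAction 𝒜 ψ
  isUniversal : IsUniversalMeasuring 𝒜 𝒜 (Subalgebra.toSubmodule V) ψ

/-- `(H, ρ)` is a `V`-universal coacting bialgebra: a `V`-universal comeasuring algebra from `A`
to itself, with the (unique) bialgebra structure for which `ρ` is a coaction. -/
structure IsUniversalCoacting (𝒜 : OmegaAlgebra F s t A) (V : Subalgebra F (Module.End F A))
    {H : Type u} [Ring H] [Bialgebra F H] (ρ : A →ₗ[F] A ⊗[F] H) : Prop where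
  isCoaction : IsCoaction 𝒜 ρ
  isUniversal : IsUniversalComeasuring 𝒜 𝒜 (Subalgebra.toSubmodule V) ρ

/-- The `V`-universal acting bialgebra exists. -/
def HasUniversalActing (𝒜 : OmegaAlgebra F s t A) (V : Subalgebra F (Module.End F A)) : Prop :=
  ∃ (H : Type u) (_ : Ring H) (_ : Bialgebra F H) (ψ : H ⊗[F] A →ₗ[F] A),
    IsUniversalActing 𝒜 V ψ

/-- The `V`-universal coacting bialgebra exists. -/
def HasUniversalCoacting (𝒜 : OmegaAlgebra F s t A) (V : Subalgebra F (Module.End F A)) : Prop :=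
  ∃ (H : Type u) (_ : Ring H) (_ : Bialgebra F H) (ρ : A →ₗ[F] A ⊗[F] H),
    IsUniversalCoacting 𝒜 V ρ

end Universal

/-! ### Unital algebras and coalgebras as Omega-algebras -/

/-- The operations of a unital algebra. -/
inductive AlgOp : Type
  | mul
  | unit

/-- The arity of an operation of a unital algebra. -/
def AlgOp.source : AlgOp → ℕ
  | .mul => 2
  | .unit => 0

/-- The coarity of an operation of a unital algebra. -/
def AlgOp.target : AlgOp → ℕ
  | .mul => 1
  | .unit => 1

/-- A unital associative algebra as an `Ω`-algebra with `Ω = {μ, u}`. -/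
def algebraOmega (F : Type u) [Field F] (A : Type v) [Ring A] [Algebra F A] :
    OmegaAlgebra F AlgOp.source AlgOp.target A where
  op
    | .mul => (powOne F A).symm.toLinearMap ∘ₗ LinearMap.mul' F A ∘ₗ
        ((powOne F A).rTensor A).toLinearMap ∘ₗ (powSucc F A 1).toLinearMap
    | .unit => (powOne F A).symm.toLinearMap ∘ₗ Algebra.linearMap F A ∘ₗ
        (powZero F A).toLinearMap

/-- The operations of a coalgebra. -/
inductive CoalgOp : Type
  | comul
  | counit

/-- The arity of an operation of a coalgebra. -/
def CoalgOp.source : CoalgOp → ℕ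
  | .comul => 1
  | .counit => 1

/-- The coarity of an operation of a coalgebra. -/
def CoalgOp.target : CoalgOp → ℕ
  | .comul => 2
  | .counit => 0

/-- A coalgebra as an `Ω`-algebra with `Ω = {Δ, ε}`. -/
def coalgebraOmega (F : Type u) [Field F] (C : Type v) [AddCommGroup C] [Module F C]
    [Coalgebra F C] : OmegaAlgebra F CoalgOp.source CoalgOp.target C where
  op
    | .comul => (powSucc F C 1).symm.toLinearMap ∘ₗ ((powOne F C).symm.rTensor C).toLinearMap ∘ₗ
        Coalgebra.comul ∘ₗ (powOne F C).toLinearMap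
    | .counit => (powZero F C).symm.toLinearMap ∘ₗ Coalgebra.counit ∘ₗ (powOne F C).toLinearMap

end OmegaDuality

end

open OmegaDuality

noncomputable section

namespace OmegaDuality

/-! ### Slices of tensors -/

section Slices

variable {F : Type u} [Field F] {M N M' N' : Type*} [AddCommGroup M] [Module F M]
  [AddCommGroup N] [Module F N] [AddCommGroup M'] [Module F M'] [AddCommGroup N'] [Module F N']

/-! A map `ρ : A → B ⊗ Q` is determined by its matrix coefficients, a linear map `matCoeff ρ : B* ⊗
A → Q`. Since `q (matCoeff ρ z) = evalCoeff (veeHom ρ q) z`, the cosupport condition becomes linear: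
if the cosupport lies in `V`, then `matCoeff ρ` kills `coeffRelations V`, the annihilator of `V` in
`B* ⊗ A`. The converse is where closedness of `V` enters (`IsFinitelyClosed.coactCosupp_le`).
Pointwise finite dimensionality makes every linear map that kills the relations come from some `ρ`
(`IsPointwiseFiniteDimensional.exists_matCoeff`). Hence the universal comeasuring algebra `Q` is the
free algebra on `(B* ⊗ A) / coeffRelations V`, divided by the equations that force a comeasuring.
For `B = A` and `V` a subalgebra, `ρ` composed with itself and `a ↦ a ⊗ 1` are again comeasurings
with cosupport in `V`; universality turns them into `Δ` and `ε`, and its uniqueness part gives the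
bialgebra axioms.

The duality is a chain of bijections. For a coalgebra `P` with convolution algebra `P*`, measurings
`P ⊗ A → B` with cosupport in `V` correspond to comeasurings `A → B ⊗ P*` with cosupport in `V`,
these to algebra maps `Q → P*`, and these to coalgebra maps `P → Q°`. The first step is
`IsPointwiseFiniteDimensional.exists_convCoaction` with `IsDualPairing.isComeasuring`. The last
works because a comultiplication is a finite sum, so the functionals that `P` induces on `Q` lie in
`Q°` (`IsDualPairing.mem_finiteDual`). Thus `Q°` with the restriction of `ρ^∨` is terminal
(`IsUniversalComeasuring.isUniversalMeasuring_veeFin`).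

For a bialgebra `Q` coacting on `A` this restriction is an action of `Q°`. A coalgebra map
compatible with the actions, into a universal acting bialgebra, respects units and products, because
the coalgebra maps to be compared induce the same measuring (`IsUniversalActing.exists_bialgHom`).
Hence `θ` is an isomorphism of bialgebras, and it is unique already as a coalgebra map. -/

/-- Apply a functional to the second factor of a tensor. -/
def rightSlice : Module.Dual F N →ₗ[F] M ⊗[F] N →ₗ[F] M :=
  (LinearMap.compRight F (TensorProduct.rid F M).toLinearMap) ∘ₗ LinearMap.lTensorHom M

/-- Apply a functional to the first factor of a tensor. -/
def leftSlice : Module.Dual F M →ₗ[F] M ⊗[F] N →ₗ[F] N :=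
  (LinearMap.compRight F (TensorProduct.lid F N).toLinearMap) ∘ₗ LinearMap.rTensorHom N

@[simp] theorem rightSlice_tmul (q : Module.Dual F N) (m : M) (n : N) :
    rightSlice q (m ⊗ₜ n) = q n • m := by
  simp [rightSlice]

@[simp] theorem leftSlice_tmul (χ : Module.Dual F M) (m : M) (n : N) :
    leftSlice χ (m ⊗ₜ n) = χ m • n := by
  simp [leftSlice]

theorem apply_rightSlice (χ : Module.Dual F M) (q : Module.Dual F N) (t : M ⊗[F] N) :
    χ (rightSlice q t) = pairing χ q t := by
  induction t with
  | zero => simp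
  | add x y hx hy => simp only [map_add, hx, hy]
  | tmul m n => simp [mul_comm]

theorem apply_leftSlice (χ : Module.Dual F M) (q : Module.Dual F N) (t : M ⊗[F] N) :
    q (leftSlice χ t) = pairing χ q t := by
  induction t with
  | zero => simp
  | add x y hx hy => simp only [map_add, hx, hy]
  | tmul m n => simp

theorem leftSlice_lTensor (φ : N →ₗ[F] N') (χ : Module.Dual F M) (t : M ⊗[F] N) :
    leftSlice χ (φ.lTensor M t) = φ (leftSlice χ t) := by
  induction t with
  | zero => simp
  | add x y hx hy => simp only [map_add, hx, hy]
  | tmul m n => simp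

theorem rightSlice_lTensor (φ : N →ₗ[F] N') (q : Module.Dual F N') (t : M ⊗[F] N) :
    rightSlice q (φ.lTensor M t) = rightSlice (q ∘ₗ φ) t := by
  induction t with
  | zero => simp
  | add x y hx hy => simp only [map_add, hx, hy]
  | tmul m n => simp

theorem rightSlice_rTensor (φ : M →ₗ[F] M') (q : Module.Dual F N) (t : M ⊗[F] N) :
    rightSlice q (φ.rTensor N t) = φ (rightSlice q t) := by
  induction t with
  | zero => simp
  | add x y hx hy => simp only [map_add, hx, hy]
  | tmul m n => simp

/-- A separating family of functionals on the second factor separates tensors by slices. -/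
theorem tensor_ext_rightSlice {Y : Type*} (χ : Y → Module.Dual F N)
    (hχ : ∀ n, (∀ y, χ y n = 0) → n = 0) {s t : M ⊗[F] N}
    (h : ∀ y, rightSlice (χ y) s = rightSlice (χ y) t) : s = t := by
  rw [← sub_eq_zero]
  refine tensor_eq_zero_of_pairing (fun φ : Module.Dual F M => φ) χ
    (fun m hm => (Module.forall_dual_apply_eq_zero_iff F m).1 hm) hχ _ fun φ y => ?_
  rw [← apply_rightSlice, map_sub, h, sub_self, map_zero]

theorem tensor_ext_leftSlice {s t : M ⊗[F] N}
    (h : ∀ χ : Module.Dual F M, leftSlice χ s = leftSlice χ t) : s = t := by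
  rw [← sub_eq_zero]
  refine tensor_eq_zero_of_pairing (fun φ : Module.Dual F M => φ) (fun χ : Module.Dual F N => χ)
    (fun m hm => (Module.forall_dual_apply_eq_zero_iff F m).1 hm)
    (fun m hm => (Module.forall_dual_apply_eq_zero_iff F m).1 hm) _ fun φ y => ?_
  rw [← apply_leftSlice, map_sub, h, sub_self, map_zero]

end Slices

/-! ### Matrix coefficients -/

section MatrixCoefficients

variable {F : Type u} [Field F] {A B : Type*} [AddCommGroup A] [Module F A]
  [AddCommGroup B] [Module F B]

theorem veeHom_apply {Q : Type*} [AddCommGroup Q] [Module F Q] (ρ : A →ₗ[F] B ⊗[F] Q)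
    (q : Module.Dual F Q) (a : A) : veeHom ρ q a = rightSlice q (ρ a) := rfl

theorem mem_coactCosupp {Q : Type*} [AddCommGroup Q] [Module F Q] {ρ : A →ₗ[F] B ⊗[F] Q}
    {f : A →ₗ[F] B} : f ∈ coactCosupp ρ ↔ ∃ q, veeHom ρ q = f := Iff.rfl

/-- The span of the matrix coefficients of `ρ`, as the image of a linear map `B* ⊗ A → Q`. -/
def matCoeff {Q : Type*} [AddCommGroup Q] [Module F Q] (ρ : A →ₗ[F] B ⊗[F] Q) :
    Module.Dual F B ⊗[F] A →ₗ[F] Q :=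
  TensorProduct.lift (LinearMap.lcomp F Q ρ ∘ₗ leftSlice)

@[simp] theorem matCoeff_tmul {Q : Type*} [AddCommGroup Q] [Module F Q] (ρ : A →ₗ[F] B ⊗[F] Q)
    (χ : Module.Dual F B) (a : A) : matCoeff ρ (χ ⊗ₜ a) = leftSlice χ (ρ a) := rfl

theorem matCoeff_injective {Q : Type*} [AddCommGroup Q] [Module F Q] {ρ σ : A →ₗ[F] B ⊗[F] Q}
    (h : matCoeff ρ = matCoeff σ) : ρ = σ := by
  ext a
  refine tensor_ext_leftSlice fun χ => ?_
  exact LinearMap.congr_fun h (χ ⊗ₜ a)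

theorem matCoeff_lTensor {Q Q' : Type*} [AddCommGroup Q] [Module F Q] [AddCommGroup Q']
    [Module F Q'] (ρ : A →ₗ[F] B ⊗[F] Q) (φ : Q →ₗ[F] Q') :
    matCoeff (φ.lTensor B ∘ₗ ρ) = φ ∘ₗ matCoeff ρ := by
  ext χ a
  simp [leftSlice_lTensor]

/-- The functional `χ ⊗ a ↦ χ (f a)` on `B* ⊗ A`. -/
def evalCoeff (f : A →ₗ[F] B) : Module.Dual F B ⊗[F] A →ₗ[F] F :=
  contractLeft F B ∘ₗ f.lTensor (Module.Dual F B)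

@[simp] theorem evalCoeff_tmul (f : A →ₗ[F] B) (χ : Module.Dual F B) (a : A) :
    evalCoeff f (χ ⊗ₜ a) = χ (f a) := by
  simp [evalCoeff]

/-- The bridge between matrix coefficients and cosupports: it lets the relations of `V` be tested by
functionals on `Q`. -/
theorem apply_matCoeff {Q : Type*} [AddCommGroup Q] [Module F Q] (ρ : A →ₗ[F] B ⊗[F] Q)
    (q : Module.Dual F Q) (z : Module.Dual F B ⊗[F] A) :
    q (matCoeff ρ z) = evalCoeff (veeHom ρ q) z := by
  induction z with
  | zero => simp
  | add x y hx hy => simp only [map_add, hx, hy]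
  | tmul χ a => simp [apply_leftSlice, veeHom_apply, apply_rightSlice]

/-- The relations between the matrix coefficients of the elements of `V`. -/
def coeffRelations (V : Submodule F (A →ₗ[F] B)) : Submodule F (Module.Dual F B ⊗[F] A) where
  carrier := {z | ∀ f ∈ V, evalCoeff f z = 0}
  zero_mem' f _ := map_zero _
  add_mem' hx hy f hf := by rw [map_add, hx f hf, hy f hf, add_zero]
  smul_mem' c x hx f hf := by rw [map_smul, hx f hf, smul_zero]

/-- If the operators `ρ^∨(q)` lie in `V` for a separating family of functionals `q`, then the
matrix coefficients of `ρ` satisfy the relations of `V`. -/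
theorem coeffRelations_le_ker {V : Submodule F (A →ₗ[F] B)} {Q Y : Type*} [AddCommGroup Q]
    [Module F Q] {ρ : A →ₗ[F] B ⊗[F] Q} (χ : Y → Module.Dual F Q)
    (hχ : ∀ n, (∀ y, χ y n = 0) → n = 0) (h : ∀ y, veeHom ρ (χ y) ∈ V) :
    coeffRelations V ≤ LinearMap.ker (matCoeff ρ) := by
  intro z hz
  refine hχ _ fun y => ?_
  rw [apply_matCoeff]
  exact hz _ (h y)

theorem coeffRelations_le_ker_of_cosupp {V : Submodule F (A →ₗ[F] B)} {Q : Type*}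
    [AddCommGroup Q] [Module F Q] {ρ : A →ₗ[F] B ⊗[F] Q} (h : coactCosupp ρ ≤ V) :
    coeffRelations V ≤ LinearMap.ker (matCoeff ρ) :=
  coeffRelations_le_ker (fun q : Module.Dual F Q => q)
    (fun m hm => (Module.forall_dual_apply_eq_zero_iff F m).1 hm)
    fun q => h (mem_coactCosupp.2 ⟨q, rfl⟩)

/-- A finitely closed subspace contains every map that agrees with members of it on finite sets. -/
theorem IsFinitelyClosed.mem_of_forall_finset {V : Submodule F (A →ₗ[F] B)}
    (hV : IsFinitelyClosed V) {f : A →ₗ[F] B}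
    (h : ∀ S : Finset A, ∃ v ∈ V, ∀ a ∈ S, v a = f a) : f ∈ V := by
  classical
  by_contra hf
  -- Every open neighbourhood of `f` contains all maps agreeing with `f` on some finite set; the
  -- complement of `V` would then contain a member of `V`.
  have key : ∀ W : Set (A →ₗ[F] B), TopologicalSpace.GenerateOpen
      {W | ∃ (n : ℕ) (a : Fin n → A) (b : Fin n → B), W = {f | ∀ i, f (a i) = b i}} W →
      f ∈ W → ∃ S : Finset A, ∀ g : A →ₗ[F] B, (∀ a ∈ S, g a = f a) → g ∈ W := by
    intro W hW
    induction hW with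
    | basic W hW =>
      obtain ⟨n, a, b, rfl⟩ := hW
      intro hf
      refine ⟨Finset.univ.image a, fun g hg i => ?_⟩
      rw [hg _ (Finset.mem_image_of_mem _ (Finset.mem_univ i))]
      exact hf i
    | univ => exact fun _ => ⟨∅, fun _ _ => trivial⟩
    | inter W W' _ _ h h' =>
      intro hf
      obtain ⟨S, hS⟩ := h hf.1
      obtain ⟨S', hS'⟩ := h' hf.2
      exact ⟨S ∪ S', fun g hg => ⟨hS g fun a ha => hg a (Finset.mem_union_left _ ha),
        hS' g fun a ha => hg a (Finset.mem_union_right _ ha)⟩⟩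
    | sUnion 𝒲 _ h =>
      rintro ⟨W, hW, hf⟩
      obtain ⟨S, hS⟩ := h W hW hf
      exact ⟨S, fun g hg => ⟨W, hW, hS g hg⟩⟩
  obtain ⟨S, hS⟩ := key _ hV.isOpen_compl hf
  obtain ⟨v, hv, hva⟩ := h S
  exact hS v hva hv

/-- If the relations of a finitely closed subspace hold for the matrix coefficients of `ρ`, then
the cosupport of `ρ` is contained in the subspace. -/
theorem IsFinitelyClosed.coactCosupp_le {V : Submodule F (A →ₗ[F] B)} (hV : IsFinitelyClosed V)
    {Q : Type*} [AddCommGroup Q] [Module F Q] {ρ : A →ₗ[F] B ⊗[F] Q}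
    (h : coeffRelations V ≤ LinearMap.ker (matCoeff ρ)) : coactCosupp ρ ≤ V := by
  classical
  intro f hf
  obtain ⟨q, rfl⟩ := mem_coactCosupp.1 hf
  refine hV.mem_of_forall_finset fun S => ?_
  -- Approximation on `S` is membership in the image of `V` under restriction to `S`. Were it to
  -- fail, a functional on `S → B` would separate the restriction from that image.
  let R : (A →ₗ[F] B) →ₗ[F] (S → B) := LinearMap.pi fun a => LinearMap.applyₗ (a : A)
  suffices hR : R (veeHom ρ q) ∈ V.map R by
    obtain ⟨v, hv, hvR⟩ := hR
    exact ⟨v, hv, fun a ha => congrFun hvR ⟨a, ha⟩⟩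
  by_contra hR
  obtain ⟨χ, hχ, hχV⟩ := Submodule.exists_le_ker_of_notMem hR
  -- Finiteness of `S` makes the separating functional an element of `B* ⊗ A`. It annihilates `V`,
  -- so it is a relation, killed by `matCoeff ρ` and hence by `q ∘ matCoeff ρ`.
  have hχR : ∀ g : A →ₗ[F] B, χ (R g) =
      evalCoeff g (∑ a : S, (χ ∘ₗ LinearMap.single F (fun _ => B) a) ⊗ₜ[F] (a : A)) := by
    intro g
    rw [map_sum]
    simp only [evalCoeff_tmul, LinearMap.comp_apply]
    rw [← map_sum]
    congr 1
    exact (Finset.univ_sum_single (R g)).symm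
  apply hχ
  rw [hχR, ← apply_matCoeff, LinearMap.mem_ker.1 (h _), map_zero]
  intro v hv
  rw [← hχR]
  exact hχV (Submodule.mem_map_of_mem hv)

variable {V : Submodule F (A →ₗ[F] B)}

/-- On `V a`, with finite basis `e` and coordinate functionals extended to `c i` on `B`, each `χ`
agrees with `∑ χ (e i) • c i`. So `χ ⊗ a` and `(∑ χ (e i) • c i) ⊗ a` differ by a relation of `V`,
and finitely many coefficients determine the whole family `τ (χ ⊗ a)`. -/
theorem IsPointwiseFiniteDimensional.exists_tensor (hV : IsPointwiseFiniteDimensional V)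
    {Q : Type*} [AddCommGroup Q] [Module F Q] (τ : Module.Dual F B ⊗[F] A →ₗ[F] Q)
    (hτ : coeffRelations V ≤ LinearMap.ker τ) (a : A) :
    ∃ t : B ⊗[F] Q, ∀ χ : Module.Dual F B, leftSlice χ t = τ (χ ⊗ₜ a) := by
  have := hV a
  let W := V.map (LinearMap.applyₗ a)
  let e := Module.finBasis F W
  choose c hc using fun i => LinearMap.exists_extend (e.coord i)
  refine ⟨∑ i, (e i : B) ⊗ₜ τ (c i ⊗ₜ a), fun χ => ?_⟩
  simp only [map_sum, leftSlice_tmul, ← map_smul]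
  rw [← map_sum, ← sub_eq_zero, ← map_sub]
  refine LinearMap.mem_ker.1 (hτ fun f hf => ?_)
  have hfa : f a ∈ W := ⟨f, hf, rfl⟩
  have hci : ∀ i, c i (f a) = e.repr ⟨f a, hfa⟩ i := fun i =>
    LinearMap.congr_fun (hc i) ⟨f a, hfa⟩
  have hs := congrArg (fun w : W => χ w) (e.sum_repr ⟨f a, hfa⟩)
  simp only [Submodule.coe_sum, Submodule.coe_smul, map_sum, map_smul] at hs
  simp only [map_sub, map_sum, map_smul, evalCoeff_tmul, hci]
  rw [← hs, sub_eq_zero]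
  exact Finset.sum_congr rfl fun i _ => by simp [mul_comm]

/-- A linear map on `B* ⊗ A` that vanishes on the relations of `V` comes from a map
`A → B ⊗ Q`. -/
theorem IsPointwiseFiniteDimensional.exists_matCoeff (hV : IsPointwiseFiniteDimensional V)
    {Q : Type*} [AddCommGroup Q] [Module F Q] (τ : Module.Dual F B ⊗[F] A →ₗ[F] Q)
    (hτ : coeffRelations V ≤ LinearMap.ker τ) :
    ∃ ρ : A →ₗ[F] B ⊗[F] Q, matCoeff ρ = τ := by
  choose r hr using hV.exists_tensor τ hτ
  refine ⟨{ toFun := r, map_add' := fun a b => ?_, map_smul' := fun c a => ?_ }, ?_⟩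
  · refine tensor_ext_leftSlice fun χ => ?_
    rw [map_add, hr, hr, hr, TensorProduct.tmul_add, map_add]
  · refine tensor_ext_leftSlice fun χ => ?_
    rw [map_smul, hr, hr, TensorProduct.tmul_smul, map_smul, RingHom.id_apply]
  · ext χ a
    exact hr a χ

end MatrixCoefficients

/-! ### Functoriality of the powers of coactions and actions -/

section Powers

variable {F : Type u} [Field F] {A B C : Type*} [AddCommGroup A] [Module F A]
  [AddCommGroup B] [Module F B] [AddCommGroup C] [Module F C]

theorem comeasPow_lTensor {Q Q' : Type*} [Ring Q] [Algebra F Q] [Ring Q'] [Algebra F Q']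
    (ρ : A →ₗ[F] B ⊗[F] Q) (φ : Q →ₐ[F] Q') (n : ℕ) (x : ⨂[F]^n A) :
    comeasPow (φ.toLinearMap.lTensor B ∘ₗ ρ) n x =
      φ.toLinearMap.lTensor (⨂[F]^n B) (comeasPow ρ n x) := by
  induction n with
  | zero => simp [comeasPow]
  | succ n ih =>
    obtain ⟨y, rfl⟩ := (powSucc F A n).symm.surjective x
    simp only [comeasPow, LinearMap.comp_apply, LinearEquiv.coe_coe, LinearEquiv.apply_symm_apply]
    induction y with
    | zero => simp only [map_zero]
    | add y y' hy hy' => simp only [map_add, hy, hy']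
    | tmul y a =>
      simp only [TensorProduct.map_tmul, ih, LinearMap.comp_apply]
      -- Both sides are linear in each of the two images, so they may be replaced by arbitrary
      -- tensors and then by pure ones.
      generalize comeasPow ρ n y = s
      generalize ρ a = t
      induction s with
      | zero => simp
      | add s s' hs hs' => simp only [TensorProduct.add_tmul, map_add, hs, hs']
      | tmul b q =>
        induction t with
        | zero => simp
        | add t t' ht ht' => simp only [TensorProduct.tmul_add, map_add, ht, ht']
        | tmul b' q' => simp

/-- The composition of two coactions. -/
def coactComp {Q Q' : Type*} [AddCommGroup Q] [Module F Q] [AddCommGroup Q'] [Module F Q']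
    (ρ : B →ₗ[F] C ⊗[F] Q) (σ : A →ₗ[F] B ⊗[F] Q') : A →ₗ[F] C ⊗[F] (Q ⊗[F] Q') :=
  (TensorProduct.assoc F C Q Q').toLinearMap ∘ₗ ρ.rTensor Q' ∘ₗ σ

theorem coactComp_apply {Q Q' : Type*} [AddCommGroup Q] [Module F Q] [AddCommGroup Q']
    [Module F Q'] (ρ : B →ₗ[F] C ⊗[F] Q) (σ : A →ₗ[F] B ⊗[F] Q') (a : A) :
    coactComp ρ σ a = TensorProduct.assoc F C Q Q' (ρ.rTensor Q' (σ a)) := rfl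

theorem comeasPow_succ_tmul {Q : Type*} [Ring Q] [Algebra F Q] (ρ : A →ₗ[F] B ⊗[F] Q) (n : ℕ)
    (y : ⨂[F]^n A) (a : A) : comeasPow ρ (n + 1) ((powSucc F A n).symm (y ⊗ₜ a)) =
      TensorProduct.map (powSucc F B n).symm.toLinearMap (LinearMap.mul' F Q)
        (TensorProduct.tensorTensorTensorComm F (⨂[F]^n B) Q B Q (comeasPow ρ n y ⊗ₜ ρ a)) := by
  simp [comeasPow]

/-- Multiplication in `Q ⊗ Q'` is factorwise, so the product of the coefficients of a composite
splits into a product in `Q` and one in `Q'`. -/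
theorem comeasPow_coactComp {Q Q' : Type*} [Ring Q] [Algebra F Q] [Ring Q'] [Algebra F Q']
    (ρ : B →ₗ[F] C ⊗[F] Q) (σ : A →ₗ[F] B ⊗[F] Q') (n : ℕ) (x : ⨂[F]^n A) :
    comeasPow (coactComp ρ σ) n x = coactComp (comeasPow ρ n) (comeasPow σ n) x := by
  induction n with
  | zero =>
    simp [comeasPow, coactComp, Algebra.TensorProduct.one_def, Algebra.algebraMap_eq_smul_one,
      TensorProduct.smul_tmul']
    simp only [← TensorProduct.smul_tmul', TensorProduct.tmul_smul]
  | succ n ih =>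
    obtain ⟨y, rfl⟩ := (powSucc F A n).symm.surjective x
    induction y with
    | zero => simp only [map_zero]
    | add y y' hy hy' => simp only [map_add, hy, hy']
    | tmul y a =>
      simp only [comeasPow_succ_tmul, ih, coactComp_apply]
      generalize comeasPow σ n y = s
      generalize σ a = t
      induction s with
      | zero => simp only [map_zero, TensorProduct.zero_tmul]
      | add s s' hs hs' => simp only [TensorProduct.add_tmul, map_add, hs, hs']
      | tmul b q =>
        induction t with
        | zero => simp only [map_zero, TensorProduct.tmul_zero]
        | add t t' ht ht' => simp only [TensorProduct.tmul_add, map_add, ht, ht']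
        | tmul b' q' =>
          simp only [LinearMap.rTensor_tmul, TensorProduct.tensorTensorTensorComm_tmul,
            TensorProduct.map_tmul, LinearEquiv.coe_coe, comeasPow_succ_tmul]
          generalize comeasPow ρ n b = s
          generalize ρ b' = t
          induction s with
          | zero => simp only [map_zero, TensorProduct.zero_tmul]
          | add s s' hs hs' => simp only [TensorProduct.add_tmul, map_add, hs, hs']
          | tmul c r =>
            induction t with
            | zero => simp only [map_zero, TensorProduct.zero_tmul, TensorProduct.tmul_zero]
            | add t t' ht ht' =>
              simp only [TensorProduct.tmul_add, TensorProduct.add_tmul, map_add, ht, ht']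
            | tmul c' r' => simp

/-- The powers of the trivial coaction with values in the base field. -/
theorem comeasPow_trivial (n : ℕ) (x : ⨂[F]^n A) :
    comeasPow (TensorProduct.rid F A).symm.toLinearMap n x = x ⊗ₜ (1 : F) := by
  induction n with
  | zero =>
    apply (TensorProduct.rid F _).injective
    apply (powZero F A).injective
    simp [comeasPow]
  | succ n ih =>
    obtain ⟨y, rfl⟩ := (powSucc F A n).symm.surjective x
    induction y with
    | zero => simp only [map_zero, TensorProduct.zero_tmul]
    | add y y' hy hy' => simp only [map_add, hy, hy', TensorProduct.add_tmul]
    | tmul y a => simp [comeasPow_succ_tmul, ih]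

/-- The powers of `ψ` use only the comultiplication and counit of the coalgebra, and `φ` preserves
both. -/
theorem measPow_rTensor {P P' : Type*} [AddCommGroup P] [Module F P] [Coalgebra F P]
    [AddCommGroup P'] [Module F P'] [Coalgebra F P'] (ψ : P ⊗[F] A →ₗ[F] B) (φ : P' →ₗc[F] P)
    (n : ℕ) (p : P') (x : ⨂[F]^n A) :
    measPow (ψ ∘ₗ φ.toLinearMap.rTensor A) n (p ⊗ₜ x) = measPow ψ n (φ p ⊗ₜ x) := by
  induction n generalizing p with
  | zero => simp [measPow]
  | succ n ih =>
    obtain ⟨y, rfl⟩ := (powSucc F A n).symm.surjective x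
    simp only [measPow, LinearMap.comp_apply, LinearEquiv.coe_coe, LinearEquiv.apply_symm_apply,
      TensorProduct.map_tmul, ← CoalgHomClass.map_comp_comul_apply]
    generalize Coalgebra.comul (R := F) p = t
    congr 1
    induction y with
    | zero => simp
    | add y y' hy hy' => simp only [TensorProduct.tmul_add, map_add, hy, hy']
    | tmul y a =>
      induction t with
      | zero => simp
      | add t t' ht ht' => simp only [TensorProduct.add_tmul, map_add, ht, ht']
      | tmul p p' =>
        simp only [TensorProduct.tensorTensorTensorComm_tmul, TensorProduct.map_tmul, ih,
          LinearMap.comp_apply, LinearMap.rTensor_tmul]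
        rfl

/-- A linear map from a coalgebra to the dual of an algebra whose transpose is an algebra
homomorphism to the convolution algebra. -/
structure IsDualPairing {D Q : Type*} [AddCommGroup D] [Module F D] [Coalgebra F D] [Ring Q]
    [Algebra F Q] (κ : D →ₗ[F] Module.Dual F Q) : Prop where
  map_one : ∀ d, κ d 1 = Coalgebra.counit (R := F) d
  map_mul : ∀ d x y, κ d (x * y) = pairing (κ.flip x) (κ.flip y) (Coalgebra.comul (R := F) d)

variable {D Q : Type*} [AddCommGroup D] [Module F D] [Coalgebra F D] [Ring Q] [Algebra F Q]

/-- Compatible families of maps `ψ (d ⊗ -) = (id ⊗ κ d) ρ` have compatible powers. -/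
theorem IsDualPairing.measPow_eq {κ : D →ₗ[F] Module.Dual F Q} (hκ : IsDualPairing κ)
    {ψ : D ⊗[F] A →ₗ[F] B} {ρ : A →ₗ[F] B ⊗[F] Q}
    (h : ∀ d a, ψ (d ⊗ₜ a) = rightSlice (κ d) (ρ a)) (n : ℕ) (d : D) (x : ⨂[F]^n A) :
    measPow ψ n (d ⊗ₜ x) = rightSlice (κ d) (comeasPow ρ n x) := by
  induction n generalizing d with
  | zero =>
    apply (powZero F B).injective
    simp [measPow, comeasPow, Algebra.algebraMap_eq_smul_one, hκ.map_one, mul_comm]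
  | succ n ih =>
    obtain ⟨y, rfl⟩ := (powSucc F A n).symm.surjective x
    simp only [measPow, comeasPow, LinearMap.comp_apply, LinearEquiv.coe_coe,
      LinearEquiv.apply_symm_apply, TensorProduct.map_tmul]
    induction y with
    | zero => simp
    | add y y' hy hy' => simp only [TensorProduct.tmul_add, map_add, hy, hy']
    | tmul y a =>
      simp only [TensorProduct.map_tmul]
      -- The inductive hypothesis is needed at the first tensor factor of the comultiplication of
      -- `d`, hence the generalization over `d`. What remains afterwards is the rule for `κ d` on
      -- products.
      have h1 : ∀ t : D ⊗[F] D, TensorProduct.map (measPow ψ n) ψ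
          (TensorProduct.tensorTensorTensorComm F D D (⨂[F]^n A) A (t ⊗ₜ (y ⊗ₜ a))) =
          TensorProduct.map ((rightSlice (F := F)).flip (comeasPow ρ n y) ∘ₗ κ)
            (rightSlice.flip (ρ a) ∘ₗ κ) t := by
        intro t
        induction t with
        | zero => simp
        | add t t' ht ht' => simp only [TensorProduct.add_tmul, map_add, ht, ht']
        | tmul p p' => simp [ih, h]
      rw [h1]
      generalize comeasPow ρ n y = s
      generalize ρ a = t
      induction s with
      | zero => simp
      | add s s' hs hs' =>
        simp only [TensorProduct.add_tmul, map_add, ← hs, ← hs', LinearMap.add_comp,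
          TensorProduct.map_add_left, LinearMap.add_apply]
      | tmul b q =>
        induction t with
        | zero => simp
        | add t t' ht ht' =>
          simp only [TensorProduct.tmul_add, map_add, ← ht, ← ht', LinearMap.add_comp,
            TensorProduct.map_add_right, LinearMap.add_apply]
        | tmul b' q' =>
          simp only [TensorProduct.tensorTensorTensorComm_tmul, TensorProduct.map_tmul,
            rightSlice_tmul, LinearMap.mul'_apply, hκ.map_mul, LinearEquiv.coe_coe]
          rw [← map_smul]
          congr 1
          generalize Coalgebra.comul (R := F) d = t
          induction t with
          | zero => simp
          | add t t' ht ht' => simp only [map_add, ht, ht', add_smul]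
          | tmul p p' => simp [TensorProduct.smul_tmul', TensorProduct.tmul_smul, smul_smul, mul_comm]

variable {Ω : Type w} {s t : Ω → ℕ} {𝒜 : OmegaAlgebra F s t A} {ℬ : OmegaAlgebra F s t B}
  {𝒞 : OmegaAlgebra F s t C}

theorem IsComeasuring.lTensor {Q Q' : Type*} [Ring Q] [Algebra F Q] [Ring Q'] [Algebra F Q']
    {ρ : A →ₗ[F] B ⊗[F] Q} (h : IsComeasuring 𝒜 ℬ ρ) (φ : Q →ₐ[F] Q') :
    IsComeasuring 𝒜 ℬ (φ.toLinearMap.lTensor B ∘ₗ ρ) := by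
  intro ω x
  rw [comeasPow_lTensor, comeasPow_lTensor, h, ← LinearMap.comp_apply,
    LinearMap.lTensor_comp_rTensor, ← LinearMap.rTensor_comp_lTensor, LinearMap.comp_apply]

theorem IsComeasuring.comp {Q Q' : Type*} [Ring Q] [Algebra F Q] [Ring Q'] [Algebra F Q']
    {ρ : B →ₗ[F] C ⊗[F] Q} {σ : A →ₗ[F] B ⊗[F] Q'} (hρ : IsComeasuring ℬ 𝒞 ρ)
    (hσ : IsComeasuring 𝒜 ℬ σ) : IsComeasuring 𝒜 𝒞 (coactComp ρ σ) := by
  intro ω x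
  rw [comeasPow_coactComp, comeasPow_coactComp]
  simp only [coactComp, LinearMap.comp_apply, hσ ω, LinearEquiv.coe_coe]
  generalize comeasPow σ (s ω) x = y
  induction y with
  | zero => simp
  | add y y' hy hy' => simp only [map_add, hy, hy']
  | tmul b q =>
    simp only [LinearMap.rTensor_tmul, hρ ω]
    generalize comeasPow ρ (s ω) b = z
    induction z with
    | zero => simp
    | add z z' hz hz' => simp only [TensorProduct.add_tmul, map_add, hz, hz']
    | tmul c r => simp

theorem IsComeasuring.trivial :
    IsComeasuring 𝒜 𝒜 (TensorProduct.rid F A).symm.toLinearMap := by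
  intro ω x
  rw [comeasPow_trivial, comeasPow_trivial, LinearMap.rTensor_tmul]

theorem IsMeasuring.rTensor {P P' : Type*} [AddCommGroup P] [Module F P] [Coalgebra F P]
    [AddCommGroup P'] [Module F P'] [Coalgebra F P'] {ψ : P ⊗[F] A →ₗ[F] B}
    (h : IsMeasuring 𝒜 ℬ ψ) (φ : P' →ₗc[F] P) :
    IsMeasuring 𝒜 ℬ (ψ ∘ₗ φ.toLinearMap.rTensor A) := by
  intro ω p x
  rw [measPow_rTensor, measPow_rTensor, h]

theorem IsDualPairing.isMeasuring {κ : D →ₗ[F] Module.Dual F Q} (hκ : IsDualPairing κ)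
    {ψ : D ⊗[F] A →ₗ[F] B} {ρ : A →ₗ[F] B ⊗[F] Q}
    (h : ∀ d a, ψ (d ⊗ₜ a) = rightSlice (κ d) (ρ a)) (hρ : IsComeasuring 𝒜 ℬ ρ) :
    IsMeasuring 𝒜 ℬ ψ := by
  intro ω d x
  rw [hκ.measPow_eq h, hκ.measPow_eq h, hρ, rightSlice_rTensor]

/-- Slicing the comeasuring identity by `κ d` gives the measuring identity at `d`; as the `κ d`
separate `Q`, no information is lost. -/
theorem IsDualPairing.isComeasuring {κ : D →ₗ[F] Module.Dual F Q} (hκ : IsDualPairing κ)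
    (hsep : ∀ x, (∀ d, κ d x = 0) → x = 0)
    {ψ : D ⊗[F] A →ₗ[F] B} {ρ : A →ₗ[F] B ⊗[F] Q}
    (h : ∀ d a, ψ (d ⊗ₜ a) = rightSlice (κ d) (ρ a)) (hψ : IsMeasuring 𝒜 ℬ ψ) :
    IsComeasuring 𝒜 ℬ ρ := by
  intro ω x
  refine tensor_ext_rightSlice (fun d => κ d) hsep fun d => ?_
  rw [rightSlice_rTensor, ← hκ.measPow_eq h, ← hκ.measPow_eq h, hψ]

end Powers

/-! ### The universal coacting bialgebra -/

section Coacting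

variable {F : Type u} [Field F] {A B : Type u} [AddCommGroup A] [Module F A]
  [AddCommGroup B] [Module F B] {Ω : Type w} {s t : Ω → ℕ}

/-- The universal quotient of an algebra by a relation. -/
theorem exists_universal_quotient {Q : Type u} [Ring Q] [Algebra F Q] (r : Q → Q → Prop) :
    ∃ (Q₁ : Type u) (_ : Ring Q₁) (_ : Algebra F Q₁) (π : Q →ₐ[F] Q₁),
      (∀ x y, r x y → π x = π y) ∧
      ∀ (R : Type u) [Ring R] [Algebra F R] (φ : Q →ₐ[F] R), (∀ x y, r x y → φ x = φ y) →
        ∃! χ : Q₁ →ₐ[F] R, χ.comp π = φ := by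
  refine ⟨RingQuot r, inferInstance, inferInstance, RingQuot.mkAlgHom F r,
    fun x y h => RingQuot.mkAlgHom_rel F h, fun R _ _ φ h => ?_⟩
  exact ⟨RingQuot.liftAlgHom F ⟨φ, h⟩,
    AlgHom.ext fun x => RingQuot.liftAlgHom_mkAlgHom_apply F φ h x,
    fun χ hχ => RingQuot.liftAlgHom_unique F φ h χ hχ⟩

/-- The free algebra on a quotient of a vector space. -/
theorem exists_free_algebra {M : Type u} [AddCommMonoid M] [Module F M] (K : Submodule F M) :
    ∃ (Q : Type u) (_ : Ring Q) (_ : Algebra F Q) (τ : M →ₗ[F] Q), K ≤ LinearMap.ker τ ∧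
      ∀ (R : Type u) [Ring R] [Algebra F R] (σ : M →ₗ[F] R), K ≤ LinearMap.ker σ →
        ∃! φ : Q →ₐ[F] R, φ.toLinearMap ∘ₗ τ = σ := by
  obtain ⟨Q, _, _, π, hπ, huniv⟩ := exists_universal_quotient (F := F)
    fun x y : TensorAlgebra F M => ∃ z ∈ K, x = TensorAlgebra.ι F z ∧ y = 0
  refine ⟨Q, _, _, π.toLinearMap ∘ₗ TensorAlgebra.ι F, fun z hz => ?_, fun R _ _ σ hσ => ?_⟩
  · exact (hπ _ _ ⟨z, hz, rfl, rfl⟩).trans (map_zero π)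
  · obtain ⟨φ, hφ, hφ'⟩ := huniv R (TensorAlgebra.lift F σ) (by
      rintro _ _ ⟨z, hz, rfl, rfl⟩
      rw [TensorAlgebra.lift_ι_apply, map_zero]
      exact hσ hz)
    refine ⟨φ, LinearMap.ext fun z => ?_, fun χ hχ => hφ' χ (TensorAlgebra.hom_ext ?_)⟩
    · exact (AlgHom.congr_fun hφ (TensorAlgebra.ι F z)).trans (TensorAlgebra.lift_ι_apply _ _)
    · refine LinearMap.ext fun z => ?_
      exact (LinearMap.congr_fun hχ z).trans (TensorAlgebra.lift_ι_apply _ _).symm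

/-- The defects of `ρ : A → B ⊗ Q` from being a comeasuring, as a relation on `Q`. -/
def ComeasuringDefect (𝒜 : OmegaAlgebra F s t A) (ℬ : OmegaAlgebra F s t B) {Q : Type*} [Ring Q]
    [Algebra F Q] (ρ : A →ₗ[F] B ⊗[F] Q) (x y : Q) : Prop :=
  ∃ (ω : Ω) (z : ⨂[F]^(s ω) A) (χ : Module.Dual F (⨂[F]^(t ω) B)),
    x = leftSlice χ (comeasPow ρ (t ω) (𝒜.op ω z)) ∧
      y = leftSlice χ ((ℬ.op ω).rTensor Q (comeasPow ρ (s ω) z))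

/-- Left slices separate tensors and commute with maps of the coefficient algebra, so being a
comeasuring is a set of equations in that algebra. -/
theorem isComeasuring_lTensor_iff {𝒜 : OmegaAlgebra F s t A} {ℬ : OmegaAlgebra F s t B}
    {Q Q' : Type*} [Ring Q] [Algebra F Q] [Ring Q'] [Algebra F Q'] (ρ : A →ₗ[F] B ⊗[F] Q)
    (φ : Q →ₐ[F] Q') : IsComeasuring 𝒜 ℬ (φ.toLinearMap.lTensor B ∘ₗ ρ) ↔
      ∀ x y, ComeasuringDefect 𝒜 ℬ ρ x y → φ x = φ y := by
  have key : ∀ ω z, (ℬ.op ω).rTensor Q' (φ.toLinearMap.lTensor _ (comeasPow ρ (s ω) z)) =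
      φ.toLinearMap.lTensor _ ((ℬ.op ω).rTensor Q (comeasPow ρ (s ω) z)) := by
    intro ω z
    rw [← LinearMap.comp_apply, LinearMap.rTensor_comp_lTensor, ← LinearMap.lTensor_comp_rTensor,
      LinearMap.comp_apply]
  constructor
  · rintro h _ _ ⟨ω, z, χ, rfl, rfl⟩
    have := congrArg (leftSlice χ) (h ω z)
    rw [comeasPow_lTensor, comeasPow_lTensor, key, leftSlice_lTensor, leftSlice_lTensor] at this
    exact this
  · intro h ω z
    refine tensor_ext_leftSlice fun χ => ?_
    rw [comeasPow_lTensor, comeasPow_lTensor, key, leftSlice_lTensor, leftSlice_lTensor]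
    exact h _ _ ⟨ω, z, χ, rfl, rfl⟩

theorem coactCosupp_lTensor_le {Q Q' : Type*} [AddCommGroup Q] [Module F Q] [AddCommGroup Q']
    [Module F Q'] (ρ : A →ₗ[F] B ⊗[F] Q) (φ : Q →ₗ[F] Q') :
    coactCosupp (φ.lTensor B ∘ₗ ρ) ≤ coactCosupp ρ := by
  rintro _ ⟨q, rfl⟩
  refine mem_coactCosupp.2 ⟨q ∘ₗ φ, ?_⟩
  ext a
  exact (rightSlice_lTensor φ q (ρ a)).symm

/-- The universal comeasuring algebra exists for a pointwise finite dimensional and finitely closed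
space of maps. -/
theorem exists_isUniversalComeasuring (𝒜 : OmegaAlgebra F s t A) (ℬ : OmegaAlgebra F s t B)
    {V : Submodule F (A →ₗ[F] B)} (hV : IsPointwiseFiniteDimensional V)
    (hV' : IsFinitelyClosed V) :
    ∃ (Q : Type u) (_ : Ring Q) (_ : Algebra F Q) (ρ : A →ₗ[F] B ⊗[F] Q),
      IsUniversalComeasuring 𝒜 ℬ V ρ := by
  -- `Q₀` carries the universal map with cosupport in `V`, with no comeasuring condition yet; the
  -- quotient `Q` below imposes that condition.
  obtain ⟨Q₀, _, _, τ, hτ, hfree⟩ := exists_free_algebra (coeffRelations V)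
  obtain ⟨ρ₀, hρ₀⟩ := hV.exists_matCoeff τ hτ
  obtain ⟨Q, _, _, π, hπ, hquot⟩ :=
    exists_universal_quotient (F := F) (ComeasuringDefect 𝒜 ℬ ρ₀)
  have hcomp : ∀ (Q' : Type u) [Ring Q'] [Algebra F Q'] (φ : Q →ₐ[F] Q'),
      φ.toLinearMap.lTensor B ∘ₗ π.toLinearMap.lTensor B ∘ₗ ρ₀ =
        (φ.comp π).toLinearMap.lTensor B ∘ₗ ρ₀ := by
    intro Q' _ _ φ
    rw [AlgHom.comp_toLinearMap, LinearMap.lTensor_comp, LinearMap.comp_assoc]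
  refine ⟨Q, _, _, π.toLinearMap.lTensor B ∘ₗ ρ₀, (isComeasuring_lTensor_iff ρ₀ π).2 hπ,
    (coactCosupp_lTensor_le _ _).trans (hV'.coactCosupp_le (hρ₀ ▸ hτ)), ?_⟩
  intro Q' _ _ ρ' hρ' hc
  obtain ⟨φ₀, hφ₀, huniq⟩ := hfree Q' (matCoeff ρ') (coeffRelations_le_ker_of_cosupp hc)
  have h₀ : φ₀.toLinearMap.lTensor B ∘ₗ ρ₀ = ρ' :=
    matCoeff_injective (by rw [matCoeff_lTensor, hρ₀]; exact hφ₀)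
  obtain ⟨φ, hφ, hφ'⟩ := hquot Q' φ₀ ((isComeasuring_lTensor_iff ρ₀ φ₀).1 (h₀ ▸ hρ'))
  refine ⟨φ, ?_, fun χ hχ => hφ' χ (huniq _ ?_)⟩
  · change φ.toLinearMap.lTensor B ∘ₗ π.toLinearMap.lTensor B ∘ₗ ρ₀ = ρ'
    rw [hcomp, hφ, h₀]
  · change (χ.comp π).toLinearMap ∘ₗ τ = matCoeff ρ'
    rw [← hρ₀, ← matCoeff_lTensor, ← hcomp, hχ]

/-- The pushforward of `ρ` along `χ` is itself a comeasuring with cosupport in `V`, so uniqueness in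
the universal property applies to it. -/
theorem IsUniversalComeasuring.hom_ext {𝒜 : OmegaAlgebra F s t A} {ℬ : OmegaAlgebra F s t B}
    {V : Submodule F (A →ₗ[F] B)} {Q Q' : Type u} [Ring Q] [Algebra F Q] [Ring Q'] [Algebra F Q']
    {ρ : A →ₗ[F] B ⊗[F] Q} (h : IsUniversalComeasuring 𝒜 ℬ V ρ) {φ χ : Q →ₐ[F] Q'}
    (hφ : ∀ a, φ.toLinearMap.lTensor B (ρ a) = χ.toLinearMap.lTensor B (ρ a)) : φ = χ :=
  (h.existsUnique_hom Q' _ (h.isComeasuring.lTensor χ)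
    ((coactCosupp_lTensor_le _ _).trans h.cosupp_le)).unique (LinearMap.ext hφ) rfl

variable {𝒜 : OmegaAlgebra F s t A} {V : Subalgebra F (Module.End F A)}

/-- The order of the factors matches that of the composition, which is why a right coaction dualizes
to a left action. -/
theorem veeHom_coactComp {Q Q' : Type*} [AddCommGroup Q] [Module F Q] [AddCommGroup Q']
    [Module F Q'] (ρ : A →ₗ[F] A ⊗[F] Q) (σ : A →ₗ[F] A ⊗[F] Q') (q : Module.Dual F Q)
    (q' : Module.Dual F Q') :
    veeHom (coactComp ρ σ) (pairing q q') = veeHom ρ q ∘ₗ veeHom σ q' := by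
  ext a
  rw [LinearMap.comp_apply, veeHom_apply, veeHom_apply, veeHom_apply, coactComp_apply]
  generalize σ a = y
  induction y with
  | zero => simp
  | add y y' hy hy' => simp only [map_add, hy, hy']
  | tmul b r =>
    simp only [LinearMap.rTensor_tmul, rightSlice_tmul, map_smul]
    generalize ρ b = z
    induction z with
    | zero => simp
    | add z z' hz hz' => simp only [TensorProduct.add_tmul, map_add, hz, hz', smul_add]
    | tmul c r' => simp [smul_smul, mul_comm]

/-- A functional on `Q ⊗ Q'` need not be a finite sum of product functionals. Product functionals do
give operators in `V`, since `V` is closed under composition, and they separate points, so the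
relations of `V` hold; closedness then covers all functionals. -/
theorem IsFinitelyClosed.coactCosupp_coactComp_le
    (hV : IsFinitelyClosed (Subalgebra.toSubmodule V)) {Q Q' : Type*} [AddCommGroup Q]
    [Module F Q] [AddCommGroup Q'] [Module F Q'] {ρ : A →ₗ[F] A ⊗[F] Q} {σ : A →ₗ[F] A ⊗[F] Q'}
    (hρ : coactCosupp ρ ≤ Subalgebra.toSubmodule V)
    (hσ : coactCosupp σ ≤ Subalgebra.toSubmodule V) :
    coactCosupp (coactComp ρ σ) ≤ Subalgebra.toSubmodule V := by
  refine hV.coactCosupp_le (coeffRelations_le_ker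
    (fun p : Module.Dual F Q × Module.Dual F Q' => pairing p.1 p.2) (fun z hz => ?_) fun p => ?_)
  · exact tensor_eq_zero_of_pairing (fun q : Module.Dual F Q => q)
      (fun q : Module.Dual F Q' => q)
      (fun m hm => (Module.forall_dual_apply_eq_zero_iff F m).1 hm)
      (fun m hm => (Module.forall_dual_apply_eq_zero_iff F m).1 hm) z fun q q' => hz (q, q')
  · rw [veeHom_coactComp]
    exact V.mul_mem (hρ (mem_coactCosupp.2 ⟨_, rfl⟩)) (hσ (mem_coactCosupp.2 ⟨_, rfl⟩))

theorem coactCosupp_trivial_le :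
    coactCosupp (TensorProduct.rid F A).symm.toLinearMap ≤ Subalgebra.toSubmodule V := by
  rintro _ ⟨q, rfl⟩
  have : veeHom (TensorProduct.rid F A).symm.toLinearMap q = q 1 • (1 : Module.End F A) := by
    ext a
    simp [veeHom_apply]
  exact this ▸ V.smul_mem V.one_mem _

theorem lTensor_map_assoc {M Q Q' R R' : Type*} [AddCommGroup M] [Module F M] [AddCommGroup Q]
    [Module F Q] [AddCommGroup Q'] [Module F Q'] [AddCommGroup R] [Module F R] [AddCommGroup R']
    [Module F R'] (f : Q →ₗ[F] R) (g : Q' →ₗ[F] R') (y : (M ⊗[F] Q) ⊗[F] Q') :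
    (TensorProduct.map f g).lTensor M (TensorProduct.assoc F M Q Q' y) =
      TensorProduct.assoc F M R R' (TensorProduct.map (f.lTensor M) g y) := by
  have h : (TensorProduct.map f g).lTensor M ∘ₗ (TensorProduct.assoc F M Q Q').toLinearMap =
      (TensorProduct.assoc F M R R').toLinearMap ∘ₗ TensorProduct.map (f.lTensor M) g :=
    TensorProduct.ext_threefold fun m q q' => rfl
  exact LinearMap.congr_fun h y

/-- The universal comeasuring algebra of a finitely closed algebra of operators carries a bialgebra
structure for which it coacts. -/
theorem IsUniversalComeasuring.exists_bialgebra {Q : Type u} [Ring Q] [Algebra F Q]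
    {ρ : A →ₗ[F] A ⊗[F] Q} (hV : IsFinitelyClosed (Subalgebra.toSubmodule V))
    (h : IsUniversalComeasuring 𝒜 𝒜 (Subalgebra.toSubmodule V) ρ) :
    HasUniversalCoacting 𝒜 V := by
  -- The counit and the comultiplication are the algebra maps classifying `a ↦ a ⊗ 1` and `ρ`
  -- composed with itself.
  obtain ⟨ε, hε, -⟩ := h.existsUnique_hom F _ IsComeasuring.trivial coactCosupp_trivial_le
  obtain ⟨Δ, hΔ, -⟩ := h.existsUnique_hom (Q ⊗[F] Q) _ (h.isComeasuring.comp h.isComeasuring)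
    (hV.coactCosupp_coactComp_le h.cosupp_le h.cosupp_le)
  replace hε : ∀ a, ε.toLinearMap.lTensor A (ρ a) = a ⊗ₜ 1 := fun a => LinearMap.congr_fun hε a
  replace hΔ : ∀ a, Δ.toLinearMap.lTensor A (ρ a) =
      TensorProduct.assoc F A Q Q (ρ.rTensor Q (ρ a)) := fun a => LinearMap.congr_fun hΔ a
  have hε' : ∀ y : A ⊗[F] Q, TensorProduct.map (ε.toLinearMap.lTensor A) LinearMap.id
      (ρ.rTensor Q y) = ((TensorProduct.mk F A F).flip 1).rTensor Q y := by
    intro y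
    rw [LinearMap.rTensor, ← LinearMap.comp_apply, ← TensorProduct.map_comp]
    exact congrArg (fun f => TensorProduct.map f LinearMap.id y) (LinearMap.ext hε)
  have hΔ' : ∀ y : A ⊗[F] Q, TensorProduct.map (Δ.toLinearMap.lTensor A) LinearMap.id
      (ρ.rTensor Q y) = (coactComp ρ ρ).rTensor Q y := by
    intro y
    rw [LinearMap.rTensor, ← LinearMap.comp_apply, ← TensorProduct.map_comp]
    exact congrArg (fun f => TensorProduct.map f LinearMap.id y) (LinearMap.ext hΔ)
  have hmid : ∀ (R : Type u) [AddCommGroup R] [Module F R] (f : Q →ₗ[F] R) (y : A ⊗[F] Q),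
      TensorProduct.map ((LinearMap.id : Q →ₗ[F] Q).lTensor A) f (ρ.rTensor Q y) =
        ρ.rTensor R (f.lTensor A y) := by
    intro R _ _ f y
    rw [LinearMap.lTensor_id, ← LinearMap.comp_apply, ← LinearMap.comp_apply]
    congr 1
    exact TensorProduct.ext' fun a q => rfl
  -- Coassociativity and the two counit laws are equalities of algebra maps out of `Q`, so by
  -- `hom_ext` each need only be checked after applying it to the coefficients of `ρ`.
  let _ : Bialgebra F Q := Bialgebra.ofAlgHom Δ ε
    (h.hom_ext fun a => by
      have h1 : ∀ y : A ⊗[F] Q, (TensorProduct.assoc F Q Q Q).toLinearMap.lTensor A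
          (TensorProduct.assoc F A (Q ⊗[F] Q) Q ((coactComp ρ ρ).rTensor Q y)) =
          TensorProduct.assoc F A Q (Q ⊗[F] Q) (ρ.rTensor (Q ⊗[F] Q)
            (TensorProduct.assoc F A Q Q (ρ.rTensor Q y))) := by
        intro y
        induction y with
        | zero => simp only [map_zero]
        | add y y' hy hy' => simp only [map_add, hy, hy']
        | tmul b q =>
          simp only [LinearMap.rTensor_tmul, coactComp_apply]
          generalize ρ b = z
          induction z with
          | zero => simp only [map_zero, TensorProduct.zero_tmul]
          | add z z' hz hz' => simp only [TensorProduct.add_tmul, map_add, hz, hz']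
          | tmul c r =>
            simp only [LinearMap.rTensor_tmul, TensorProduct.assoc_tmul]
            generalize ρ c = z
            induction z with
            | zero => simp only [map_zero, TensorProduct.zero_tmul]
            | add z z' hz hz' => simp only [TensorProduct.add_tmul, map_add, hz, hz']
            | tmul d r' => rfl
      have hl : ((TensorProduct.assoc F Q Q Q).toLinearMap ∘ₗ
          TensorProduct.map Δ.toLinearMap LinearMap.id ∘ₗ Δ.toLinearMap).lTensor A (ρ a) =
          (TensorProduct.map LinearMap.id Δ.toLinearMap ∘ₗ Δ.toLinearMap).lTensor A (ρ a) := by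
        simp only [LinearMap.lTensor_comp, LinearMap.comp_apply, hΔ, lTensor_map_assoc, hΔ', hmid,
          h1]
      exact hl)
    (h.hom_ext fun a => by
      have h1 : ∀ y : A ⊗[F] Q, TensorProduct.assoc F A F Q
          (((TensorProduct.mk F A F).flip 1).rTensor Q y) =
          (TensorProduct.lid F Q).symm.toLinearMap.lTensor A y := by
        intro y
        induction y with
        | zero => simp only [map_zero]
        | add y y' hy hy' => simp only [map_add, hy, hy']
        | tmul b q => rfl
      have hl : (TensorProduct.map ε.toLinearMap LinearMap.id ∘ₗ Δ.toLinearMap).lTensor A (ρ a) =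
          (TensorProduct.lid F Q).symm.toLinearMap.lTensor A (ρ a) := by
        simp only [LinearMap.lTensor_comp, LinearMap.comp_apply, hΔ, lTensor_map_assoc, hε', h1]
      exact hl)
    (h.hom_ext fun a => by
      have h1 : ∀ y : A ⊗[F] Q, TensorProduct.assoc F A Q F (y ⊗ₜ 1) =
          (TensorProduct.rid F Q).symm.toLinearMap.lTensor A y := by
        intro y
        induction y with
        | zero => simp only [map_zero, TensorProduct.zero_tmul]
        | add y y' hy hy' => simp only [map_add, hy, hy', TensorProduct.add_tmul]
        | tmul b q => rfl
      have hl : (TensorProduct.map LinearMap.id ε.toLinearMap ∘ₗ Δ.toLinearMap).lTensor A (ρ a) =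
          (TensorProduct.rid F Q).symm.toLinearMap.lTensor A (ρ a) := by
        simp only [LinearMap.lTensor_comp, LinearMap.comp_apply, hΔ, lTensor_map_assoc, hmid, hε,
          LinearMap.rTensor_tmul, h1]
      exact hl)
  exact ⟨Q, inferInstance, inferInstance, ρ, ⟨⟨hε, fun a => (hΔ a).symm, h.isComeasuring⟩, h⟩⟩

end Coacting

/-! ### Dual pairings, convolution algebras and finite duals -/

section DualPairings

variable {F : Type u} [Field F] {D : Type*} [AddCommGroup D] [Module F D]

variable (F D) in
/-- The evaluation pairing between a coalgebra and its convolution algebra. -/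
def convEv : D →ₗ[F] Module.Dual F (WithConv (D →ₗ[F] F)) :=
  (WithConv.linearEquiv F (D →ₗ[F] F)).toLinearMap.flip

@[simp] theorem convEv_apply (d : D) (f : WithConv (D →ₗ[F] F)) : convEv F D d f = f.ofConv d :=
  rfl

theorem convEv_separates (f : WithConv (D →ₗ[F] F)) (h : ∀ d, convEv F D d f = 0) : f = 0 :=
  WithConv.ofConv_injective (LinearMap.ext h)

variable [Coalgebra F D] {Q : Type*} [Ring Q] [Algebra F Q]

theorem isDualPairing_convEv : IsDualPairing (convEv F D) :=
  ⟨fun _ => rfl, fun _ _ _ => rfl⟩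

theorem IsDualPairing.comp_coalgHom {D' : Type*} [AddCommGroup D'] [Module F D'] [Coalgebra F D']
    {κ : D →ₗ[F] Module.Dual F Q} (hκ : IsDualPairing κ) (φ : D' →ₗc[F] D) :
    IsDualPairing (κ ∘ₗ φ.toLinearMap) := by
  refine ⟨fun d => (hκ.map_one _).trans (CoalgHomClass.counit_comp_apply φ d), fun d x y => ?_⟩
  refine (hκ.map_mul (φ d) x y).trans ?_
  rw [← CoalgHomClass.map_comp_comul_apply]
  generalize Coalgebra.comul (R := F) d = t
  induction t with
  | zero => simp
  | add t t' ht ht' => simp only [map_add, ht, ht']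
  | tmul p p' => simp

theorem IsDualPairing.comp_algHom {Q' : Type*} [Ring Q'] [Algebra F Q']
    {κ : D →ₗ[F] Module.Dual F Q} (hκ : IsDualPairing κ) (φ : Q' →ₐ[F] Q) :
    IsDualPairing (LinearMap.lcomp F F φ.toLinearMap ∘ₗ κ) := by
  refine ⟨fun d => ?_, fun d x y => ?_⟩
  · simp [hκ.map_one]
  · exact (congrArg (κ d) (_root_.map_mul φ x y)).trans (hκ.map_mul d (φ x) (φ y))

/-- The algebra homomorphism to the convolution algebra given by a dual pairing. -/
def IsDualPairing.convHom {κ : D →ₗ[F] Module.Dual F Q} (hκ : IsDualPairing κ) :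
    Q →ₐ[F] WithConv (D →ₗ[F] F) :=
  AlgHom.ofLinearMap ((WithConv.linearEquiv F (D →ₗ[F] F)).symm.toLinearMap ∘ₗ κ.flip)
    (WithConv.ofConv_injective (LinearMap.ext hκ.map_one))
    fun x y => WithConv.ofConv_injective (LinearMap.ext fun d => hκ.map_mul d x y)

theorem isDualPairing_toDual : IsDualPairing (FiniteDual.toDual F Q) :=
  ⟨fun _ => rfl, fun f x y => (FiniteDual.pairing_comulMap x y f).symm⟩

theorem IsDualPairing.map_mul_repr {κ : D →ₗ[F] Module.Dual F Q} (hκ : IsDualPairing κ)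
    {ι : Type*} {d : D} (r : Coalgebra.Repr F d ι) (x y : Q) :
    κ d (x * y) = ∑ i ∈ r.index, κ (r.left i) x * κ (r.right i) y := by
  rw [hκ.map_mul, ← r.eq, map_sum]
  simp

/-- Comultiplying `d`, and then each right factor, expands `κ d (x * (y * z))` as a finite sum of
products of functionals. -/
theorem IsDualPairing.mem_finiteDual {κ : D →ₗ[F] Module.Dual F Q} (hκ : IsDualPairing κ)
    (d : D) : κ d ∈ finiteDualSubmodule F Q :=
  mem_finiteDualSubmodule_of_sum _ _ _ _ _ _ _
    (hκ.map_mul_repr (Coalgebra.Repr.arbitrary F d))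
    fun _ => hκ.map_mul_repr (Coalgebra.Repr.arbitrary F _)

/-- The coalgebra homomorphism to the finite dual given by a dual pairing. -/
def IsDualPairing.coalgHom {κ : D →ₗ[F] Module.Dual F Q} (hκ : IsDualPairing κ) :
    D →ₗc[F] FiniteDual F Q :=
  let φ : D →ₗ[F] FiniteDual F Q := κ.codRestrict (finiteDualSubmodule F Q) hκ.mem_finiteDual
  { φ with
    counit_comp := LinearMap.ext hκ.map_one
    map_comp_comul := by
      refine LinearMap.ext fun d => FiniteDual.tensor_ext fun x y => ?_
      refine Eq.trans ?_ (FiniteDual.pairing_comulMap x y (φ d)).symm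
      refine Eq.trans ?_ (hκ.map_mul d x y).symm
      change pairing (FiniteDual.ev x) (FiniteDual.ev y)
        (TensorProduct.map φ φ (Coalgebra.comul (R := F) d)) = _
      generalize Coalgebra.comul (R := F) d = t
      induction t with
      | zero => simp
      | add t t' ht ht' => simp only [map_add, ht, ht']
      | tmul p p' =>
        rw [TensorProduct.map_tmul, pairing_tmul, pairing_tmul]
        rfl }

end DualPairings

/-! ### The universal measuring coalgebra and the universal acting bialgebra -/

section Acting

variable {F : Type u} [Field F] {A B : Type u} [AddCommGroup A] [Module F A]
  [AddCommGroup B] [Module F B] {Ω : Type w} {s t : Ω → ℕ}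
  {𝒜 : OmegaAlgebra F s t A} {ℬ : OmegaAlgebra F s t B}

theorem veeFin_tmul {Q : Type*} [Ring Q] [Algebra F Q] (ρ : A →ₗ[F] B ⊗[F] Q)
    (f : FiniteDual F Q) (a : A) :
    veeFin ρ (f ⊗ₜ a) = rightSlice (FiniteDual.toDual F Q f) (ρ a) := rfl

theorem IsDualPairing.veeFin_coalgHom {D : Type*} [AddCommGroup D] [Module F D] [Coalgebra F D]
    {Q : Type*} [Ring Q] [Algebra F Q] {κ : D →ₗ[F] Module.Dual F Q} (hκ : IsDualPairing κ)
    (ρ : A →ₗ[F] B ⊗[F] Q) (d : D) (a : A) :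
    veeFin ρ (hκ.coalgHom d ⊗ₜ a) = rightSlice (κ d) (ρ a) := rfl

theorem IsDualPairing.lTensor_convHom {D : Type*} [AddCommGroup D] [Module F D] [Coalgebra F D]
    {Q : Type*} [Ring Q] [Algebra F Q] {κ : D →ₗ[F] Module.Dual F Q} (hκ : IsDualPairing κ)
    (ρ : A →ₗ[F] B ⊗[F] Q) (d : D) (a : A) :
    rightSlice (convEv F D d) (hκ.convHom.toLinearMap.lTensor B (ρ a)) =
      rightSlice (κ d) (ρ a) :=
  rightSlice_lTensor _ _ _

/-- A map `P ⊗ A → B` with cosupport in `V` as a coaction of the convolution algebra of `P`. -/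
theorem IsPointwiseFiniteDimensional.exists_convCoaction {V : Submodule F (A →ₗ[F] B)}
    (hV : IsPointwiseFiniteDimensional V) {P : Type*} [AddCommGroup P] [Module F P]
    [Coalgebra F P] {ψ : P ⊗[F] A →ₗ[F] B} (hψ : actCosupp ψ ≤ V) :
    ∃ ρ : A →ₗ[F] B ⊗[F] WithConv (P →ₗ[F] F),
      (∀ p a, ψ (p ⊗ₜ a) = rightSlice (convEv F P p) (ρ a)) ∧ coeffRelations V ≤
        LinearMap.ker (matCoeff ρ) := by
  -- The coefficient of `χ ⊗ a` is the functional `p ↦ χ (ψ (p ⊗ a))`. At each `p` it evaluates the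
  -- operator `ψ (p ⊗ -)` of `V`, so `τ` kills the relations.
  let τ : Module.Dual F B ⊗[F] A →ₗ[F] WithConv (P →ₗ[F] F) :=
    TensorProduct.lift (LinearMap.mk₂ F
      (fun χ a => WithConv.toConv (χ ∘ₗ (TensorProduct.curry ψ).flip a))
      (fun _ _ _ => rfl) (fun _ _ _ => rfl)
      (fun χ a b => WithConv.ofConv_injective (LinearMap.ext fun p => by simp))
      (fun c χ a => WithConv.ofConv_injective (LinearMap.ext fun p => by simp)))
  have hτ : ∀ p z, (τ z).ofConv p = evalCoeff (TensorProduct.curry ψ p) z := by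
    intro p z
    induction z with
    | zero => simp
    | add z z' hz hz' => simp only [map_add, WithConv.ofConv_add, LinearMap.add_apply, hz, hz']
    | tmul χ a => exact (evalCoeff_tmul (TensorProduct.curry ψ p) χ a).symm
  have hker : coeffRelations V ≤ LinearMap.ker τ := fun z hz =>
    WithConv.ofConv_injective (LinearMap.ext fun p => (hτ p z).trans (hz _ (hψ ⟨p, rfl⟩)))
  obtain ⟨ρ, hρ⟩ := hV.exists_matCoeff τ hker
  refine ⟨ρ, fun p a => ?_, hρ ▸ hker⟩
  rw [← sub_eq_zero, ← Module.forall_dual_apply_eq_zero_iff F]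
  intro χ
  rw [map_sub, apply_rightSlice, ← apply_leftSlice, ← matCoeff_tmul, hρ, convEv_apply, hτ,
    evalCoeff_tmul, TensorProduct.curry_apply, sub_self]

/-- The finite dual of the universal comeasuring algebra is the universal measuring coalgebra. -/
theorem IsUniversalComeasuring.isUniversalMeasuring_veeFin {V : Submodule F (A →ₗ[F] B)}
    (hV : IsPointwiseFiniteDimensional V) (hV' : IsFinitelyClosed V) {Q : Type u} [Ring Q]
    [Algebra F Q] {ρ : A →ₗ[F] B ⊗[F] Q} (h : IsUniversalComeasuring 𝒜 ℬ V ρ) :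
    IsUniversalMeasuring 𝒜 ℬ V (veeFin ρ) where
  isMeasuring := isDualPairing_toDual.isMeasuring (veeFin_tmul ρ) h.isComeasuring
  cosupp_le := by
    rintro _ ⟨f, rfl⟩
    exact h.cosupp_le (mem_coactCosupp.2 ⟨FiniteDual.toDual F Q f, rfl⟩)
  existsUnique_hom := by
    intro P _ _ _ ψ hψ hc
    obtain ⟨ρ', hρ', hker⟩ := hV.exists_convCoaction hc
    obtain ⟨Φ, hΦ, -⟩ := h.existsUnique_hom _ ρ'
      (isDualPairing_convEv.isComeasuring convEv_separates hρ' hψ) (hV'.coactCosupp_le hker)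
    -- Transposing the classifying map `Φ : Q → P*` gives the required coalgebra map `P → Q°`.
    have hκ := isDualPairing_convEv.comp_algHom Φ
    refine existsUnique_of_exists_of_unique ⟨hκ.coalgHom, TensorProduct.ext' fun p a => ?_⟩
      fun φ₁ φ₂ h₁ h₂ => ?_
    · refine (hκ.veeFin_coalgHom ρ p a).trans ?_
      rw [hρ', ← hΦ]
      exact (rightSlice_lTensor Φ.toLinearMap (convEv F P p) (ρ a)).symm
    -- For uniqueness, transpose back: each such `φ` gives an algebra map `Q → P*` carrying `ρ` to
    -- `ρ'`, and there is only one of those.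
    · have key : ∀ φ : P →ₗc[F] FiniteDual F Q, veeFin ρ ∘ₗ φ.toLinearMap.rTensor A = ψ →
          ∀ a, (isDualPairing_toDual.comp_coalgHom φ).convHom.toLinearMap.lTensor B (ρ a) =
            ρ' a := by
        intro φ hφ a
        refine tensor_ext_rightSlice (fun p => convEv F P p) convEv_separates fun p => ?_
        rw [IsDualPairing.lTensor_convHom, ← hρ', ← hφ]
        exact (veeFin_tmul ρ (φ p) a).symm
      have hΦ : (isDualPairing_toDual.comp_coalgHom φ₁).convHom =
          (isDualPairing_toDual.comp_coalgHom φ₂).convHom :=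
        h.hom_ext fun a => (key φ₁ h₁ a).trans (key φ₂ h₂ a).symm
      refine CoalgHom.ext fun p => FiniteDual.toDual_injective (LinearMap.ext fun x => ?_)
      exact congrArg (fun f : WithConv (P →ₗ[F] F) => f.ofConv p) (AlgHom.congr_fun hΦ x)

theorem actCosupp_rTensor_le {P P' : Type*} [AddCommGroup P] [Module F P] [AddCommGroup P']
    [Module F P'] (ψ : P ⊗[F] A →ₗ[F] B) (φ : P' →ₗ[F] P) :
    actCosupp (ψ ∘ₗ φ.rTensor A) ≤ actCosupp ψ := by
  rintro _ ⟨p, rfl⟩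
  exact ⟨φ p, rfl⟩

theorem IsUniversalMeasuring.hom_ext {V : Submodule F (A →ₗ[F] B)} {P P' : Type u}
    [AddCommGroup P] [Module F P] [Coalgebra F P] [AddCommGroup P'] [Module F P']
    [Coalgebra F P'] {ψ : P ⊗[F] A →ₗ[F] B} (h : IsUniversalMeasuring 𝒜 ℬ V ψ)
    {φ χ : P' →ₗc[F] P} (hφ : ∀ p a, ψ (φ p ⊗ₜ a) = ψ (χ p ⊗ₜ a)) : φ = χ :=
  (h.existsUnique_hom P' _ (h.isMeasuring.rTensor χ)
    ((actCosupp_rTensor_le _ _).trans h.cosupp_le)).unique (TensorProduct.ext' hφ) rfl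

variable {V : Subalgebra F (Module.End F A)}

/-- The unit of `H°` is the counit of `H`, and its product is the pairing composed with `Δ`; the
counit and coassociativity laws of the coaction thus become the module axioms. -/
theorem IsCoaction.isAction_veeFin {H : Type u} [Ring H] [Bialgebra F H] {ρ : A →ₗ[F] A ⊗[F] H}
    (h : IsCoaction 𝒜 ρ) : IsAction 𝒜 (veeFin ρ) where
  one_act a := by
    have := congrArg (TensorProduct.rid F A) (h.counit_coact a)
    rw [TensorProduct.rid_tmul, one_smul] at this
    exact this
  mul_act f g a := by
    have h1 := LinearMap.congr_fun
      (veeHom_coactComp ρ ρ (FiniteDual.toDual F H f) (FiniteDual.toDual F H g)) a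
    rw [veeHom_apply, coactComp_apply, h.comul_coact, rightSlice_lTensor] at h1
    exact h1
  isMeasuring := isDualPairing_toDual.isMeasuring (veeFin_tmul ρ) h.isComeasuring

/-- The finite dual of the universal coacting bialgebra is the universal acting bialgebra. -/
theorem IsUniversalCoacting.isUniversalActing_veeFin
    (hV : IsPointwiseFiniteDimensional (Subalgebra.toSubmodule V))
    (hV' : IsFinitelyClosed (Subalgebra.toSubmodule V)) {H : Type u} [Ring H] [Bialgebra F H]
    {ρ : A →ₗ[F] A ⊗[F] H} (h : IsUniversalCoacting 𝒜 V ρ) :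
    IsUniversalActing 𝒜 V (veeFin ρ) :=
  ⟨h.isCoaction.isAction_veeFin, h.isUniversal.isUniversalMeasuring_veeFin hV hV'⟩

/-- An action with cosupport in `V` factors through the universal acting bialgebra. -/
theorem IsUniversalActing.exists_bialgHom {H K : Type u} [Ring H] [Bialgebra F H] [Ring K]
    [Bialgebra F K] {ψ : H ⊗[F] A →ₗ[F] A} {χ : K ⊗[F] A →ₗ[F] A}
    (hψ : IsUniversalActing 𝒜 V ψ) (hχ : IsAction 𝒜 χ)
    (hc : actCosupp χ ≤ Subalgebra.toSubmodule V) :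
    ∃ φ : K →ₐc[F] H, ∀ k a, ψ (φ k ⊗ₜ a) = χ (k ⊗ₜ a) := by
  obtain ⟨φ, hφ, -⟩ := hψ.isUniversal.existsUnique_hom K χ hχ.isMeasuring hc
  replace hφ : ∀ k a, ψ (φ k ⊗ₜ a) = χ (k ⊗ₜ a) := fun k a => LinearMap.congr_fun hφ (k ⊗ₜ a)
  have hone : φ.comp (Bialgebra.unitBialgHom F K : F →ₗc[F] K) =
      (Bialgebra.unitBialgHom F H : F →ₗc[F] H) := by
    refine hψ.isUniversal.hom_ext fun c a => ?_
    have h1 : (Bialgebra.unitBialgHom F K : F →ₗc[F] K) c = c • (1 : K) :=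
      Algebra.algebraMap_eq_smul_one c
    have h2 : (Bialgebra.unitBialgHom F H : F →ₗc[F] H) c = c • (1 : H) :=
      Algebra.algebraMap_eq_smul_one c
    rw [CoalgHom.comp_apply, hφ, h1, h2, ← TensorProduct.smul_tmul', ← TensorProduct.smul_tmul',
      map_smul, map_smul, hχ.one_act, hψ.isAction.one_act]
  -- In a bialgebra the product is a coalgebra map, so `hom_ext` applies on `K ⊗ K`: both sides act
  -- by `g ⊗ h ⊗ a ↦ χ (g ⊗ χ (h ⊗ a))`. The unit above is treated in the same way, with `F` in
  -- place of `K ⊗ K`.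
  have hmul : φ.comp (Bialgebra.mulCoalgHom F K) =
      (Bialgebra.mulCoalgHom F H).comp (Coalgebra.TensorProduct.map φ φ) := by
    refine hψ.isUniversal.hom_ext fun y a => ?_
    rw [CoalgHom.comp_apply, CoalgHom.comp_apply, hφ]
    induction y with
    | zero => simp
    | add y y' hy hy' => simp only [map_add, TensorProduct.add_tmul, hy, hy']
    | tmul g h =>
      have h1 : Bialgebra.mulCoalgHom F K (g ⊗ₜ h) = g * h := rfl
      have h2 : Bialgebra.mulCoalgHom F H (Coalgebra.TensorProduct.map φ φ (g ⊗ₜ h)) =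
        φ g * φ h := rfl
      rw [h1, h2, hχ.mul_act, hψ.isAction.mul_act, hφ, hφ]
  refine ⟨{ φ with map_one' := ?_, map_mul' := fun g h => ?_ }, hφ⟩
  · have := DFunLike.congr_fun hone 1
    have h1 : (Bialgebra.unitBialgHom F K : F →ₗc[F] K) 1 = 1 := map_one (algebraMap F K)
    have h2 : (Bialgebra.unitBialgHom F H : F →ₗc[F] H) 1 = 1 := map_one (algebraMap F H)
    rw [CoalgHom.comp_apply, h1, h2] at this
    exact this
  · exact DFunLike.congr_fun hmul (g ⊗ₜ h)

/-- Each object maps to the other; both round trips induce the same measuring as the identity, so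
`hom_ext` makes them identities. -/
theorem IsUniversalActing.exists_bialgEquiv {H K : Type u} [Ring H] [Bialgebra F H] [Ring K]
    [Bialgebra F K] {ψ : H ⊗[F] A →ₗ[F] A} {χ : K ⊗[F] A →ₗ[F] A}
    (hψ : IsUniversalActing 𝒜 V ψ) (hχ : IsUniversalActing 𝒜 V χ) :
    ∃ θ : K ≃ₐc[F] H, ∀ k a, ψ (θ k ⊗ₜ a) = χ (k ⊗ₜ a) := by
  obtain ⟨φ, hφ⟩ := hψ.exists_bialgHom hχ.isAction hχ.isUniversal.cosupp_le
  obtain ⟨φ', hφ'⟩ := hχ.exists_bialgHom hψ.isAction hψ.isUniversal.cosupp_le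
  refine ⟨BialgEquiv.ofBialgHom φ φ' (BialgHom.coe_coalgHom_injective ?_)
    (BialgHom.coe_coalgHom_injective ?_), hφ⟩
  · exact hψ.isUniversal.hom_ext fun h a => (hφ _ a).trans (hφ' h a)
  · exact hχ.isUniversal.hom_ext fun h a => (hφ' _ a).trans (hφ h a)

/-- Duality between the universal coacting and the universal acting bialgebra. -/
theorem universalBialgebra_duality (𝒜 : OmegaAlgebra F s t A)
    (hV : IsPointwiseFiniteDimensional (Subalgebra.toSubmodule V))
    (hV' : IsFinitelyClosed (Subalgebra.toSubmodule V)) :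
    HasUniversalCoacting 𝒜 V ∧ HasUniversalActing 𝒜 V ∧
      ∀ (Bco : Type u) [Ring Bco] [Bialgebra F Bco] (ρ : A →ₗ[F] A ⊗[F] Bco)
        (Bac : Type u) [Ring Bac] [Bialgebra F Bac] (ψ : Bac ⊗[F] A →ₗ[F] A),
        IsUniversalCoacting 𝒜 V ρ → IsUniversalActing 𝒜 V ψ →
        ∃ θ : FiniteDual F Bco ≃ₐc[F] Bac,
          (∀ (f : FiniteDual F Bco) (a : A), ψ (θ f ⊗ₜ a) = veeFin ρ (f ⊗ₜ a)) ∧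
          ∀ θ' : FiniteDual F Bco →ₐc[F] Bac,
            (∀ (f : FiniteDual F Bco) (a : A), ψ (θ' f ⊗ₜ a) = veeFin ρ (f ⊗ₜ a)) →
            ∀ f, θ' f = θ f := by
  obtain ⟨Q, _, _, ρ₀, h₀⟩ := exists_isUniversalComeasuring 𝒜 𝒜 hV hV'
  have hco := h₀.exists_bialgebra hV'
  refine ⟨hco, ?_, fun Bco _ _ ρ Bac _ _ ψ hρ hψ => ?_⟩
  · obtain ⟨H, _, _, ρ, hρ⟩ := hco
    exact ⟨FiniteDual F H, inferInstance, inferInstance, veeFin ρ,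
      hρ.isUniversalActing_veeFin hV hV'⟩
  · obtain ⟨θ, hθ⟩ := hψ.exists_bialgEquiv (hρ.isUniversalActing_veeFin hV hV')
    refine ⟨θ, hθ, fun θ' hθ' f => ?_⟩
    have h1 : (θ' : FiniteDual F Bco →ₗc[F] Bac) =
        ((θ : FiniteDual F Bco →ₐc[F] Bac) : FiniteDual F Bco →ₗc[F] Bac) :=
      hψ.isUniversal.hom_ext fun f a => (hθ' f a).trans (hθ f a).symm
    exact DFunLike.congr_fun h1 f

theorem isPointwiseFiniteDimensional_of_finiteDimensional [FiniteDimensional F B]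
    (V : Submodule F (A →ₗ[F] B)) : IsPointwiseFiniteDimensional V :=
  fun _ => inferInstance

theorem isFinitelyClosed_top :
    IsFinitelyClosed (Subalgebra.toSubmodule (⊤ : Subalgebra F (Module.End F A))) :=
  @isClosed_univ _ (finiteTopology F A A)

end Acting

end OmegaDuality

end

theorem mainTheorem4 (F : Type u) [Field F] :
    (∀ {Ω : Type w} (s t : Ω → ℕ) (A : Type u) [AddCommGroup A] [Module F A]
      (𝒜 : OmegaAlgebra F s t A) (V : Subalgebra F (Module.End F A)),
      IsPointwiseFiniteDimensional (Subalgebra.toSubmodule V) →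
      IsFinitelyClosed (Subalgebra.toSubmodule V) →
      HasUniversalCoacting 𝒜 V ∧ HasUniversalActing 𝒜 V ∧
      ∀ (Bco : Type u) [Ring Bco] [Bialgebra F Bco] (ρ : A →ₗ[F] A ⊗[F] Bco)
        (Bac : Type u) [Ring Bac] [Bialgebra F Bac] (ψ : Bac ⊗[F] A →ₗ[F] A),
        IsUniversalCoacting 𝒜 V ρ → IsUniversalActing 𝒜 V ψ →
        ∃ θ : FiniteDual F Bco ≃ₐc[F] Bac,
          (∀ (f : FiniteDual F Bco) (a : A), ψ (θ f ⊗ₜ a) = veeFin ρ (f ⊗ₜ a)) ∧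
          ∀ θ' : FiniteDual F Bco →ₐc[F] Bac,
            (∀ (f : FiniteDual F Bco) (a : A), ψ (θ' f ⊗ₜ a) = veeFin ρ (f ⊗ₜ a)) →
            ∀ f, θ' f = θ f) ∧
    (∀ (A : Type u) [Ring A] [Algebra F A] [FiniteDimensional F A],
      HasUniversalCoacting (algebraOmega F A) ⊤ ∧ HasUniversalActing (algebraOmega F A) ⊤ ∧
      ∀ (Bco : Type u) [Ring Bco] [Bialgebra F Bco] (ρ : A →ₗ[F] A ⊗[F] Bco)
        (Bac : Type u) [Ring Bac] [Bialgebra F Bac] (ψ : Bac ⊗[F] A →ₗ[F] A),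
        IsUniversalCoacting (algebraOmega F A) ⊤ ρ → IsUniversalActing (algebraOmega F A) ⊤ ψ →
        Nonempty (Bac ≃ₐc[F] FiniteDual F Bco)) ∧
    (∀ (C : Type u) [AddCommGroup C] [Module F C] [Coalgebra F C] [FiniteDimensional F C],
      HasUniversalCoacting (coalgebraOmega F C) ⊤ ∧ HasUniversalActing (coalgebraOmega F C) ⊤ ∧
      ∀ (Bco : Type u) [Ring Bco] [Bialgebra F Bco] (ρ : C →ₗ[F] C ⊗[F] Bco)
        (Bac : Type u) [Ring Bac] [Bialgebra F Bac] (ψ : Bac ⊗[F] C →ₗ[F] C),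
        IsUniversalCoacting (coalgebraOmega F C) ⊤ ρ →
        IsUniversalActing (coalgebraOmega F C) ⊤ ψ →
        Nonempty (Bac ≃ₐc[F] FiniteDual F Bco)) := by
  refine ⟨fun s t A _ _ 𝒜 V hV hV' => universalBialgebra_duality 𝒜 hV hV', fun A _ _ _ => ?_,
    fun C _ _ _ _ => ?_⟩
  · obtain ⟨h₁, h₂, h₃⟩ := universalBialgebra_duality (algebraOmega F A)
      (isPointwiseFiniteDimensional_of_finiteDimensional _) isFinitelyClosed_top
    refine ⟨h₁, h₂, fun Bco _ _ ρ Bac _ _ ψ hρ hψ => ?_⟩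
    obtain ⟨θ, -⟩ := h₃ Bco ρ Bac ψ hρ hψ
    exact ⟨θ.symm⟩
  · obtain ⟨h₁, h₂, h₃⟩ := universalBialgebra_duality (coalgebraOmega F C)
      (isPointwiseFiniteDimensional_of_finiteDimensional _) isFinitelyClosed_top
    refine ⟨h₁, h₂, fun Bco _ _ ρ Bac _ _ ψ hρ hψ => ?_⟩
    obtain ⟨θ, -⟩ := h₃ Bco ρ Bac ψ hρ hψ
    exact ⟨θ.symm⟩
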